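/- **Setting.** Consider $n$ chemical species and finitely many reactions $r$ with net stoichiometric change $\nu_r\in\mathbb{Z}^n$ and polynomial propensities $a_r\in\mathbb{R}[x_1,\dots,x_n]$. Let $q=\max\{0,\max_r\deg a_r-1\}$ and let $m\ge 0$ be a truncation order. Vectors $y=(y_L,y_H)$ have entries $y_{\mathbf k}$ indexed by the multi-indices $|\mathbf k|\le m+q$, where $y_L$ collects those with $|\mathbf k|\le m$; there are $n_L$ entries in $y_L$ and $n_L+n_H$ in total. Let $K y=y_L$, and let $A=[A_L\ A_H]$ be the matrix of the moment dynamics $\frac{d y_L}{dt}=A_Ly_L+A_Hy_H$ of the chemical master equation: row $\mathbf j$, $|\mathbf j|\le m$, of $A$ lists the coefficients of the polynomial $\sum_r a_r(x)\big((x+\nu_r)^{\mathbf j}-x^{\mathbf j}\big)$. Let $f_0,\dots,f_{n_p}$ be polynomials in $x$ (in the application they are non-negative on the reachable set $X$ of the system; this is not needed here), and let $C(X)=\{y : M_{f_i}(y)\succeq 0,\ i=0,\dots,n_p\}$, where $M_f(y)$ is obtained from $f\,b\,b^\top$, with $b$ the vector of all monomials of degree at most $\lfloor (m+q-\deg f)/2\rfloor$,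 by replacing each monomial $x^{\mathbf k}$ by $y_{\mathbf k}$. (If $\deg f>m+q$ there is no condition.) Let $y_0$ be a given vector of initial moments and let $|\mathbf j|\le m+q$. **(pwpOCP).** Let $d\ge 0$, $n_{\mathsf T}\geq 1$, $0=t_0<t_1<\dots<t_{n_{\mathsf T}}\le t_T$, and $t_f\in[t_{k-1},t_k]$ for some $k\in\{1,\dots,n_{\mathsf T}\}$. Problem (pwpOCP) is to minimize $y^k_{\mathbf j}(t_f)$ over all vectors $y^1,\dots,y^{n_{\mathsf T}}\in\mathbb{R}_d^{n_L+n_H}[t]$ of polynomials of degree at most $d$ such that - $\frac{d y^i_L}{dt}(t)=A_Ly_L^i(t)+A_Hy_H^i(t)$ for all $t\in[t_{i-1},t_i]$ and all $i$, - $y^i(t_i)=y^{i+1}(t_i)$ for $i=1,\dots,n_{\mathsf T}-1$, - $y^1(0)=y_0$, - $y^i(t)\in C(X)$ for all $t\in[t_{i-1},t_i]$ and all $i$. **(SDP).** Let $\mathsf F$ be a finite family of non-negative, absolutely continuous functions on $[0,t_T]$ whose span is closed under differentiation; write $g'=\sum_{h\in\mathsf F}D_{g,h}h$ (almost everywhere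 on $[0,t_T]$) and $\Gamma_g(\{z_h\})=A z_g+K\sum_{h}D_{g,h}z_h$. Let $\mathsf T=\{\tau_1<\dots<\tau_N\}\subset(0,t_{n_{\mathsf T}}]$ contain $t_f$, let $\tau_0=0$, and let $n_I\ge 0$. Let $\mathsf S_0$ be a set of initial data $(y_{\tau_0},\{z^l_{g,\tau_0}\}_{g\in\mathsf F,\,1\le l\le n_I})$ that contains $(y_0,0)$; for example $\mathsf S_0=\{(y_0,0)\}$. For $k'<l$ let $$\Omega_{l,k'}(u,v,s,t)=\sum_{i=1}^{l}\frac{(t-s)^{l-i}}{(l-i)!}\Big((-1)^{i+l-k'}\tbinom{i-1}{l-1-k'}v^i-(-1)^{k'}\tbinom{i-1}{k'}u^i\Big);$$ this is $(I_L^{l-1-k'}I_R^{k'}h)(s,t)$ for $h(a,b)=z^1(b)-z^1(a)$, with $(I_Lh)(s,t)=\int_s^t h(s,\sigma)\,d\sigma$ and $(I_Rh)(s,t)=\int_s^t h(\sigma,t)\,d\sigma$, when $u^i=z^i(s)$, $v^i=z^i(t)$ and $z^{i+1}$ is an antiderivative of $z^{i}$ for $i\ge1$. Problem (SDP) is to minimize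 $y_{t_f,\mathbf j}$ over all vectors $y_{\tau_r}$ and $z^l_{g,\tau_r}$ $(g\in\mathsf F,\ 0\le r\le N,\ 0\le l\le n_I)$ with $(y_{\tau_0},\{z^l_{g,\tau_0}\}_{l\ge1})\in\mathsf S_0$ and, for all $g\in\mathsf F$ and $1\le r\le N$, with $t=\tau_r$ and $s=\tau_{r-1}$: - $z^0_{g,t}=g(t)y_t$ and $y_t\in C(X)$; - for $l=1,\dots,n_I$: $\Gamma_g(\{z^l_{h,t}\}_h)=K\big(z^{l-1}_{g,t}-\frac{t^{l-1}}{(l-1)!}g(0)y_{\tau_0}\big)$ if $r=1$, and $\Gamma_g(\{z^l_{h,t}\}_h)=\left(\frac ts\right)^{l-1}\Gamma_g(\{z^l_{h,s}\}_h)+K\big(z^{l-1}_{g,t}-\left(\frac ts\right)^{l-1}z^{l-1}_{g,s}\big)$ if $r\ge2$; - $\Omega_{l,k'}(\{z^i_{g,s}\}_{i=1}^l,\{z^i_{g,t}\}_{i=1}^l,s,t)\in C(X)$ for all $0\le k'<l\le n_I$. **Claim.** 1. (pwpOCP) is equivalent to a finite SDP: there is a semidefinite program in finitely many real variables (linear objective,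 finitely many affine equations, finitely many linear matrix inequalities) and a linear map from its variables to $(\mathbb{R}_d^{n_L+n_H}[t])^{n_{\mathsf T}}$ that preserves the objective and maps the feasible set of the program onto the feasible set of (pwpOCP); in particular, the optimal values agree. 2. (pwpOCP) is a restriction of (SDP), for all choices of $\mathsf F$, $\mathsf T$, $n_I$ and $\mathsf S_0$ as above: for each feasible point $(y^1,\dots,y^{n_{\mathsf T}})$ of (pwpOCP) there is a feasible point of (SDP) with $y_{\tau_r}=y^i(\tau_r)$ whenever $\tau_r\in[t_{i-1},t_i]$, and with the same objective value. Hence the optimal value of (SDP) is at most that of (pwpOCP). -/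

import Mathlib

namespace MomentBounds

open scoped Nat

noncomputable section

/-! ## Optimization problems and finite semidefinite programs -/

/-- A minimization problem over `V`: minimize `objective` over the set `feasible`. -/
structure OptProblem (V : Type*) where
  feasible : Set V
  objective : V → ℝ

/-- The optimal value, an extended real number (`⊤` if the problem is infeasible). -/
def OptProblem.value {V : Type*} (P : OptProblem V) : EReal :=
  ⨅ x ∈ P.feasible, ((P.objective x : ℝ) : EReal)

/-- The data of a finite semidefinite program in `numVars` real variables, with a linear cost,
finitely many affine equations `eqMat *ᵥ x = eqRhs`, and finitely many linear matrix inequalities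
`constMat b + ∑ v, x v • coefMat b v ⪰ 0` given by symmetric matrices. -/
structure FiniteSDP where
  numVars : ℕ
  cost : Fin numVars → ℝ
  numEqs : ℕ
  eqMat : Matrix (Fin numEqs) (Fin numVars) ℝ
  eqRhs : Fin numEqs → ℝ
  numBlocks : ℕ
  blockSize : Fin numBlocks → ℕ
  constMat : ∀ b, Matrix (Fin (blockSize b)) (Fin (blockSize b)) ℝ
  coefMat : ∀ b, Fin numVars → Matrix (Fin (blockSize b)) (Fin (blockSize b)) ℝ
  constMat_symm : ∀ b, (constMat b).IsSymm
  coefMat_symm : ∀ b v, (coefMat b v).IsSymm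

/-- The optimization problem described by the data of a finite SDP. -/
def FiniteSDP.toProblem (S : FiniteSDP) : OptProblem (Fin S.numVars → ℝ) where
  feasible := {x | S.eqMat.mulVec x = S.eqRhs ∧
    ∀ b, (S.constMat b + ∑ v, x v • S.coefMat b v).PosSemidef}
  objective x := ∑ v, S.cost v * x v

/-- `P` is equivalent to the finite SDP `S`: there is a linear map from the variables of `S` to
those of `P` that preserves the objective and maps the feasible set of `S` onto that of `P`; in
particular, the optimal values agree. -/
def OptProblem.IsEquivalentTo {V : Type*} [AddCommGroup V] [Module ℝ V]
    (P : OptProblem V) (S : FiniteSDP) : Prop :=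
  (∃ L : (Fin S.numVars → ℝ) →ₗ[ℝ] V,
    L '' S.toProblem.feasible = P.feasible ∧
    ∀ x, S.toProblem.objective x = P.objective (L x)) ∧
  S.toProblem.value = P.value

/-! ## Reaction networks and moment dynamics -/

/-- A stochastic chemical system with `n` species, `nR` reactions and polynomial propensities:
`reactant i r` and `product i r` are the stoichiometric coefficients of species `i` in
reaction `r`. -/
structure ReactionNetwork (n nR : ℕ) where
  reactant : Fin n → Fin nR → ℕ
  product : Fin n → Fin nR → ℕ
  propensity : Fin nR → MvPolynomial (Fin n) ℝ

/-- Multi-indices in `n` variables of order at most `N`. -/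
abbrev MultiIdx (n N : ℕ) : Type := {k : Fin n →₀ ℕ // k.degree ≤ N}

instance (n N : ℕ) : Finite (MultiIdx n N) := Finsupp.finite_of_degree_le N

instance (n N : ℕ) : Fintype (MultiIdx n N) := Fintype.ofFinite _

/-- Truncated moment sequences: vectors indexed by the multi-indices of order at most `N`. -/
abbrev MomentVec (n N : ℕ) : Type := MultiIdx n N → ℝ

/-- A lower order multi-index, viewed among all multi-indices of order at most `m + q`. -/
def MultiIdx.lift {n m : ℕ} (q : ℕ) (j : MultiIdx n m) : MultiIdx n (m + q) :=
  ⟨j.1, j.2.trans (Nat.le_add_right m q)⟩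

namespace ReactionNetwork

variable {n nR : ℕ} (R : ReactionNetwork n nR)

/-- The net change of species `i` in reaction `r`. -/
def netChange (i : Fin n) (r : Fin nR) : ℤ := (R.product i r : ℤ) - (R.reactant i r : ℤ)

/-- `q = max_r deg a_r - 1`, and `0` if all propensities are constant. -/
def q : ℕ := (Finset.univ.sup fun r => (R.propensity r).totalDegree) - 1

/-- The polynomial `∑ r, a_r(x) ((x + ν_r)^j - x^j)`; under the chemical master equation, its
expected value is the time derivative of the moment with multi-index `j`. -/
def momentGenerator (j : Fin n →₀ ℕ) : MvPolynomial (Fin n) ℝ :=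
  ∑ r, R.propensity r *
    ((∏ i, (MvPolynomial.X i + MvPolynomial.C (R.netChange i r : ℝ)) ^ j i)
      - MvPolynomial.monomial j 1)

/-- The matrix `A = [A_L A_H]` of the moment dynamics `dy_L/dt = A y`: row `j`, of order at most
`m`, lists the coefficients of `momentGenerator j`, a polynomial of degree at most `|j| + q`. -/
def dynMat (m : ℕ) : Matrix (MultiIdx n m) (MultiIdx n (m + R.q)) ℝ :=
  fun j k => (R.momentGenerator j.1).coeff k.1

/-- `K v`, the lower order part of the vector `v`. -/
def low (m : ℕ) (v : MomentVec n (m + R.q)) : MomentVec n m := fun j => v (j.lift R.q)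

end ReactionNetwork

/-! ## Moment matrices and the cone `C(X)` -/

/-- The linear functional `p ↦ ∑ k, p_k y_k` on polynomials of degree at most `N`. -/
def riesz {n N : ℕ} (y : MomentVec n N) (p : MvPolynomial (Fin n) ℝ) : ℝ :=
  ∑ k : MultiIdx n N, p.coeff k.1 * y k

/-- The multi-indices of the monomials of degree at most `⌊(N - deg f) / 2⌋`; there are none if
`deg f > N`. -/
abbrev LMIIdx {n : ℕ} (N : ℕ) (f : MvPolynomial (Fin n) ℝ) : Type :=
  {β : Fin n →₀ ℕ // 2 * β.degree + f.totalDegree ≤ N}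

/-- The matrix `M_f(y)`, obtained from `f b bᵀ`, with `b` the vector of monomials of degree at
most `⌊(N - deg f) / 2⌋`, by replacing each monomial `x^k` by `y_k`. -/
def momentMatrix {n N : ℕ} (f : MvPolynomial (Fin n) ℝ) (y : MomentVec n N) :
    Matrix (LMIIdx N f) (LMIIdx N f) ℝ :=
  fun β γ => riesz y (f * MvPolynomial.monomial (β.1 + γ.1) 1)

/-- The convex cone `C(X)` described by the linear matrix inequalities `M_f(y) ⪰ 0` of the
polynomials `f i`. -/
def momentCone {n np : ℕ} (N : ℕ) (f : Fin np → MvPolynomial (Fin n) ℝ) : Set (MomentVec n N) :=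
  {y | ∀ i, (momentMatrix (f i) y).PosSemidef}

/-! ## The piecewise polynomial optimal control problem -/

/-- The problem (pwpOCP) for the breakpoints `t 0 < ⋯ < t nT`. The polynomial vector with index
`i : Fin nT` is the piece on `[t i.castSucc, t i.succ]`; the objective is the value at `tf` of
component `j` of the piece with index `k`. -/
def pwpOCP {n nR np : ℕ} (R : ReactionNetwork n nR) (m : ℕ)
    (f : Fin np → MvPolynomial (Fin n) ℝ) (y₀ : MomentVec n (m + R.q)) (d : ℕ) {nT : ℕ}
    (t : Fin (nT + 1) → ℝ) (k : Fin nT) (tf : ℝ) (j : MultiIdx n (m + R.q)) :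
    OptProblem (Fin nT → MultiIdx n (m + R.q) → Polynomial.degreeLE ℝ (d : WithBot ℕ)) where
  feasible := {y |
    (∀ i, ∀ s ∈ Set.Icc (t i.castSucc) (t i.succ), ∀ a : MultiIdx n m,
      (Polynomial.derivative (y i (a.lift R.q)).1).eval s
        = (R.dynMat m).mulVec (fun b => (y i b).1.eval s) a) ∧
    (∀ i i' : Fin nT, (i : ℕ) + 1 = i' →
      ∀ b, (y i b).1.eval (t i.succ) = (y i' b).1.eval (t i.succ)) ∧
    (∀ i : Fin nT, (i : ℕ) = 0 → ∀ b, (y i b).1.eval 0 = y₀ b) ∧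
    (∀ i, ∀ s ∈ Set.Icc (t i.castSucc) (t i.succ),
      (fun b => (y i b).1.eval s) ∈ momentCone (m + R.q) f)}
  objective y := (y k j).1.eval tf

/-! ## The maps `Ω_{l,k}` -/

/-- The operator `(I_L h)(t₁, t₂) = ∫_{t₁}^{t₂} h(t₁, t) dt`. -/
def intL {E : Type*} [NormedAddCommGroup E] [NormedSpace ℝ E] (h : ℝ → ℝ → E) : ℝ → ℝ → E :=
  fun x y => ∫ s in x..y, h x s

/-- The operator `(I_R h)(t₁, t₂) = ∫_{t₁}^{t₂} h(t, t₂) dt`. -/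
def intR {E : Type*} [NormedAddCommGroup E] [NormedSpace ℝ E] (h : ℝ → ℝ → E) : ℝ → ℝ → E :=
  fun x y => ∫ s in x..y, h s y

/-- `Ω_{l,k}(u, v, t₁, t₂)`, where the entries `s = 0, …, l - 1` of `u` and `v` stand for the
iterated generalized moments of the levels `s + 1` at `t₁` and at `t₂`. It is the algebraic
expression of `(I_L^{l-1-k} I_R^k h)(t₁, t₂)` for `h(x, y) = z¹(y) - z¹(x)`:
see `omegaMap_eq`. -/
def omegaMap {E : Type*} [AddCommGroup E] [Module ℝ E] (l k : ℕ) (u v : Fin l → E)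
    (t₁ t₂ : ℝ) : E :=
  ∑ s : Fin l, ((t₂ - t₁) ^ (l - 1 - (s : ℕ)) / ((l - 1 - (s : ℕ))! : ℝ)) •
    (((-1 : ℝ) ^ ((s : ℕ) + (l - 1 - k)) * ((s : ℕ).choose (l - 1 - k) : ℝ)) • v s
      - ((-1 : ℝ) ^ k * ((s : ℕ).choose k : ℝ)) • u s)

section OmegaFormula

variable {E : Type*} [NormedAddCommGroup E] [NormedSpace ℝ E]

/-- Auxiliary sums for the proof of `omegaMap_eq`. -/
def omegaAux (ζ : ℕ → ℝ → E) (c d : ℕ → ℝ) (L : ℕ) (x y : ℝ) : E :=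
  ∑ s ∈ Finset.range (L + 1), ((y - x) ^ (L - s) / ((L - s)! : ℝ)) • (c s • ζ s y - d s • ζ s x)

theorem pow_div_fact_deriv (n : ℕ) (x y : ℝ) :
    HasDerivAt (fun y : ℝ => (y - x) ^ (n+1) / ((n+1)! : ℝ)) ((y - x) ^ n / (n ! : ℝ)) y := by
  have h := (((hasDerivAt_id' y).sub_const x).pow (n+1)).div_const ((n+1)! : ℝ)
  refine h.congr_deriv ?_
  have h1 : (n ! : ℝ) ≠ 0 := by positivity
  have h2 : (n + 1 : ℝ) ≠ 0 := by positivity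
  have h3 : (((n+1)! : ℕ) : ℝ) = (n + 1) * (n ! : ℝ) := by rw [Nat.factorial_succ]; push_cast; ring
  rw [h3]
  simp only [Nat.add_sub_cancel]
  push_cast
  field_simp

theorem omegaAux_deriv (ζ : ℕ → ℝ → E) (hz : ∀ s t, HasDerivAt (ζ (s + 1)) (ζ s t) t)
    (c d : ℕ → ℝ) (h0 : c 0 = 0) (L : ℕ) (x y : ℝ) :
    HasDerivAt (omegaAux ζ c d (L+1) x) (omegaAux ζ (fun s => c s + c (s+1)) d L x y) y := by
  have hz' : ∀ s, HasDerivAt (fun y => c s • ζ s y - d s • ζ s x) (c s • ζ (s-1) y) y := by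
    intro s
    rcases s with _ | s
    · simp only [h0, zero_smul]; exact hasDerivAt_const _ _
    · simpa using ((hz s y).const_smul (c (s+1))).sub_const (d (s+1) • ζ (s+1) x)
  have hp := fun n => pow_div_fact_deriv n x y
  have key : HasDerivAt (omegaAux ζ c d (L+1) x)
      ((∑ s ∈ Finset.range (L+1), (((y - x) ^ (L - s) / ((L - s)! : ℝ)) • (c s • ζ s y - d s • ζ s x)
        + ((y - x) ^ (L + 1 - s) / ((L + 1 - s)! : ℝ)) • (c s • ζ (s-1) y))) + c (L+1) • ζ L y) y := by
    have e : omegaAux ζ c d (L+1) x = fun y => (∑ s ∈ Finset.range (L+1),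
        ((y - x) ^ (L + 1 - s) / ((L + 1 - s)! : ℝ)) • (c s • ζ s y - d s • ζ s x))
        + (c (L+1) • ζ (L+1) y - d (L+1) • ζ (L+1) x) := by
      funext y
      rw [omegaAux, Finset.sum_range_succ]; simp
    rw [e]
    refine HasDerivAt.add (HasDerivAt.fun_sum fun s hs => ?_) (hz' (L+1))
    have hs' : s ≤ L := by simpa [Nat.lt_succ_iff] using hs
    have := (hp (L - s)).smul (hz' s)
    rw [show L - s + 1 = L + 1 - s by omega] at this
    exact this.congr_deriv (add_comm _ _)
  refine key.congr_deriv (Eq.symm ?_)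
  rw [Finset.sum_add_distrib, add_assoc]
  have : (∑ s ∈ Finset.range (L+1), ((y - x) ^ (L + 1 - s) / ((L + 1 - s)! : ℝ)) • (c s • ζ (s-1) y))
      + c (L+1) • ζ L y = ∑ s ∈ Finset.range (L+2), ((y - x) ^ (L + 1 - s) / ((L + 1 - s)! : ℝ)) • (c s • ζ (s-1) y) := by
    rw [Finset.sum_range_succ _ (L+1)]; simp
  rw [this, Finset.sum_range_succ' _ (L+1), h0, zero_smul, smul_zero, add_zero, ← Finset.sum_add_distrib, omegaAux]
  refine Finset.sum_congr rfl fun s _ => ?_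
  simp only [Nat.add_sub_add_right, Nat.add_sub_cancel]
  rw [← smul_add]; congr 1; module

theorem omegaAux_swap (ζ : ℕ → ℝ → E) (c d : ℕ → ℝ) (L : ℕ) (x y : ℝ) :
    omegaAux ζ c d L x y = omegaAux ζ (fun s => (-1)^(L+s+1) * d s) (fun s => (-1)^(L+s+1) * c s) L y x := by
  refine Finset.sum_congr rfl fun s hs => ?_
  have hs' : s ≤ L := by simpa [Nat.lt_succ_iff] using hs
  obtain ⟨r, rfl⟩ := Nat.exists_eq_add_of_le hs'
  have : (y - x)^r = (-1)^r * (x - y)^r := by rw [← mul_pow]; ring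
  simp only [Nat.add_sub_cancel_left, this]
  have h2 : (-1:ℝ)^(s + r + s + 1) = - (-1)^r := by
    rw [show s + r + s + 1 = 2*s + (r+1) by ring, pow_add, pow_mul]; simp [pow_succ]
  rw [h2]; module

theorem omegaAux_cont (ζ : ℕ → ℝ → E) (hc : ∀ s, Continuous (ζ s)) (c d : ℕ → ℝ) (L : ℕ) (x : ℝ) :
    Continuous (omegaAux ζ c d L x) := by
  unfold omegaAux; 
  have := hc
  fun_prop

theorem omegaAux_self (ζ : ℕ → ℝ → E) (c d : ℕ → ℝ) (L : ℕ) (x : ℝ) (h : c L = d L) : omegaAux ζ c d L x x = 0 := by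
  rw [omegaAux, Finset.sum_range_succ]
  simp only [sub_self, h, smul_zero, add_zero]
  refine Finset.sum_eq_zero fun s hs => ?_
  have : L - s ≠ 0 := by have := Finset.mem_range.1 hs; omega
  simp [this]

theorem omegaAux_int [CompleteSpace E] (ζ : ℕ → ℝ → E) (hc : ∀ s, Continuous (ζ s)) (hz : ∀ s t, HasDerivAt (ζ (s + 1)) (ζ s t) t)
    (c d : ℕ → ℝ) (h0 : c 0 = 0) (L : ℕ) (h : c (L+1) = d (L+1)) (x y : ℝ) :
    ∫ s in x..y, omegaAux ζ (fun s => c s + c (s+1)) d L x s = omegaAux ζ c d (L+1) x y := by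
  rw [intervalIntegral.integral_eq_sub_of_hasDerivAt (fun t _ => omegaAux_deriv ζ hz c d h0 L x t)
    ((omegaAux_cont ζ hc _ _ L x).intervalIntegrable _ _), omegaAux_self ζ c d _ x h, sub_zero]

/-- If `ζ s` is the iterated generalized moment of level `s + 1`, then `omegaMap` computes the
iterated integrals that define `Ω_{l,k}`, with `l = a + k + 1`. -/
theorem omegaMap_eq [CompleteSpace E] (ζ : ℕ → ℝ → E) (hc : Continuous (ζ 0)) (hz : ∀ s t, HasDerivAt (ζ (s + 1)) (ζ s t) t)
    (a k : ℕ) (x y : ℝ) :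
    (intL^[a] (intR^[k] fun x y => ζ 0 y - ζ 0 x)) x y
      = omegaMap (a + k + 1) k (fun s => ζ s x) (fun s => ζ s y) x y := by
  have hc' : ∀ s, Continuous (ζ s) := by
    intro s; rcases s with _ | s
    · exact hc
    · exact continuous_iff_continuousAt.2 fun t => (hz s t).continuousAt
  have e : ∀ a k x y, omegaMap (a + k + 1) k (fun s => ζ s x) (fun s => ζ s y) x y
      = omegaAux ζ (fun s => (-1)^(s+a) * (s.choose a : ℝ)) (fun s => (-1)^k * (s.choose k : ℝ)) (a+k) x y := by
    intro a k x y
    rw [omegaAux, Finset.sum_range, omegaMap]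
    simp
  have hR : ∀ k, (intR^[k] fun x y => ζ 0 y - ζ 0 x) = fun x y =>
      omegaAux ζ (fun s => (-1)^(s+0) * (s.choose 0 : ℝ)) (fun s => (-1)^k * (s.choose k : ℝ)) (0+k) x y := by
    intro k
    induction k with
    | zero => funext x y; simp [omegaAux]
    | succ k ih =>
      rw [Function.iterate_succ_apply', ih]
      funext x y
      rw [intR, intervalIntegral.integral_symm, omegaAux_swap _ _ _ _ x y, zero_add, zero_add]
      rw [← omegaAux_int ζ hc' hz _ _ (by simp) k]
      · rw [← intervalIntegral.integral_neg]
        congr 1; funext t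
        rw [omegaAux_swap _ _ _ _ t y]
        simp only [omegaAux, ← Finset.sum_neg_distrib, ← smul_neg]
        refine Finset.sum_congr rfl fun s hs => ?_
        congr 1
        simp only [Nat.choose_succ_succ s k, Nat.choose_zero_right]
        push_cast
        have h3 : (-1:ℝ)^(k+1+s+1) * ((-1)^(k+1)) = -(-1)^s * ((-1)^(k+1))^2 := by ring
        have h4 : ((-1:ℝ)^(k+1))^2 = 1 := by rw [← pow_mul, mul_comm, pow_mul]; simp
        have h5 : ((-1:ℝ)^s)^2 = 1 := by rw [← pow_mul, mul_comm, pow_mul]; simp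
        have h6 : ((-1:ℝ)^k)^2 = 1 := by rw [← pow_mul, mul_comm, pow_mul]; simp
        match_scalars <;> ring_nf <;> simp only [add_comm 1 k] <;> ring
      · simp only [Nat.choose_self, Nat.choose_zero_right]
  have hL : ∀ a, (intL^[a] (intR^[k] fun x y => ζ 0 y - ζ 0 x)) = fun x y =>
      omegaAux ζ (fun s => (-1)^(s+a) * (s.choose a : ℝ)) (fun s => (-1)^k * (s.choose k : ℝ)) (a+k) x y := by
    intro a
    induction a with
    | zero => exact hR k
    | succ a ih =>
      rw [Function.iterate_succ_apply', ih]
      funext x y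
      rw [intL, show a + 1 + k = (a + k) + 1 by ring]
      rw [← omegaAux_int ζ hc' hz _ _ (by simp) (a+k)]
      · congr 1; funext t
        congr 1; funext s
        rw [Nat.choose_succ_succ s a]; push_cast; ring
      · have : (a+k+1).choose (a+1) = (a+k+1).choose k := by
          exact Nat.choose_symm_of_eq_add (by ring)
        rw [this, show a + k + 1 + (a+1) = 2 * (a+1) + k by ring, pow_add, pow_mul]; simp
  rw [hL, e]

end OmegaFormula

/-! ## The bounding semidefinite program -/

/-- The finite family `g` of test functions is admissible on `[0, tT]`: its members are absolutely
continuous and non-negative, and their span is closed under differentiation, as witnessed by the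
coefficients `D`: `(g a)' = ∑ b, D a b * g b` almost everywhere on `[0, tT]`. -/
structure IsTestFamily {nF : ℕ} (tT : ℝ) (g : Fin nF → ℝ → ℝ) (D : Matrix (Fin nF) (Fin nF) ℝ) :
    Prop where
  absCont : ∀ a, AbsolutelyContinuousOnInterval (g a) 0 tT
  nonneg : ∀ a, ∀ s ∈ Set.Icc 0 tT, 0 ≤ g a s
  deriv_mem_span : ∀ a, ∀ᵐ s ∂(MeasureTheory.volume.restrict (Set.Icc 0 tT)),
    HasDerivAt (g a) (∑ b, D a b * g b s) s

/-- The decision variables of (SDP): `y r` is the moment vector at the time point with index `r`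
(index `0` is the initial time), `z a r l` is the iterated generalized moment vector of level `l`
for the test function with index `a` at that time point. -/
structure SDPVars (n N nF nS nI : ℕ) where
  y : Fin (nS + 1) → MomentVec n N
  z : Fin nF → Fin (nS + 1) → Fin (nI + 1) → MomentVec n N

/-- The map `Γ_g` for the test function `g` with index `a`: with `g' = ∑ b, D a b * g_b`, the
expression `A z(g) + K z(g')` is `A (z a) + K (∑ b, D a b • z b)`. -/
def gammaMap {n nR nF : ℕ} (R : ReactionNetwork n nR) (m : ℕ) (D : Matrix (Fin nF) (Fin nF) ℝ)
    (a : Fin nF) (z : Fin nF → MomentVec n (m + R.q)) : MomentVec n m :=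
  (R.dynMat m).mulVec (z a) + R.low m (∑ b, D a b • z b)

/-- The set `S(F, T, n_I)` for the time points `T = {τ 1 < ⋯ < τ nS}`, with `τ 0 = 0`. The left
neighbour of `τ r.succ` is `τ r.castSucc`, and the level `l ∈ {1, …, n_I}` is the value of
`l.succ` for `l : Fin n_I`. -/
def spectrahedron {n nR np nF nS : ℕ} (R : ReactionNetwork n nR) (m : ℕ)
    (f : Fin np → MvPolynomial (Fin n) ℝ) (g : Fin nF → ℝ → ℝ) (D : Matrix (Fin nF) (Fin nF) ℝ)
    (τ : Fin (nS + 1) → ℝ) (nI : ℕ) : Set (SDPVars n (m + R.q) nF nS nI) :=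
  {x |
    (∀ a, ∀ r : Fin nS, x.z a r.succ 0 = g a (τ r.succ) • x.y r.succ) ∧
    (∀ r : Fin nS, x.y r.succ ∈ momentCone (m + R.q) f) ∧
    (∀ a, ∀ r : Fin nS, ∀ l : Fin nI,
      gammaMap R m D a (fun b => x.z b r.succ l.succ) =
        if (r : ℕ) = 0 then
          R.low m (x.z a r.succ l.castSucc
            - (τ r.succ ^ (l : ℕ) / ((l : ℕ)! : ℝ) * g a 0) • x.y 0)
        else
          (τ r.succ / τ r.castSucc) ^ (l : ℕ) •
              gammaMap R m D a (fun b => x.z b r.castSucc l.succ)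
            + R.low m (x.z a r.succ l.castSucc
              - (τ r.succ / τ r.castSucc) ^ (l : ℕ) • x.z a r.castSucc l.castSucc)) ∧
    (∀ a, ∀ r : Fin nS, ∀ l k : ℕ, ∀ hl : l ≤ nI, k < l →
      omegaMap l k
        (fun s : Fin l => x.z a r.castSucc ⟨s + 1, by omega⟩)
        (fun s : Fin l => x.z a r.succ ⟨s + 1, by omega⟩)
        (τ r.castSucc) (τ r.succ) ∈ momentCone (m + R.q) f)}

/-- The problem (SDP) with the set `S₀` of admissible initial data: the initial moment vector and
the iterated generalized moments of the levels `1, …, n_I` at time `0`. The objective is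
component `j` of the moment vector at the time point `τ p.succ`. -/
def boundingSDP {n nR np nF nS : ℕ} (R : ReactionNetwork n nR) (m : ℕ)
    (f : Fin np → MvPolynomial (Fin n) ℝ) (g : Fin nF → ℝ → ℝ) (D : Matrix (Fin nF) (Fin nF) ℝ)
    (τ : Fin (nS + 1) → ℝ) (nI : ℕ)
    (S₀ : Set (MomentVec n (m + R.q) × (Fin nF → Fin nI → MomentVec n (m + R.q))))
    (p : Fin nS) (j : MultiIdx n (m + R.q)) :
    OptProblem (SDPVars n (m + R.q) nF nS nI) where
  feasible := {x | x ∈ spectrahedron R m f g D τ nI ∧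
    (x.y 0, fun a (l : Fin nI) => x.z a 0 l.succ) ∈ S₀}
  objective x := x.y p.succ j

end

end MomentBounds

/-! Equivalence with a finite SDP. The unknowns are finitely many polynomial coefficients. The
dynamics, continuity and initial conditions are affine in them, and although the dynamics are
imposed at infinitely many times, in finite dimension such a system reduces to finitely many
equations (`exists_finite_affine_system`). What remains is positivity of a polynomial matrix of
degree at most d on an interval [a, b]. The substitution x ↦ (a + b x²)/(1 + x²) sends the real line
onto [a, b), so after clearing denominators positivity on [a, b] becomes positivity on the whole
line of a polynomial matrix of degree at most 2d (`posSemidef_on_Icc_iff`), and this is equivalent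
to having a positive semidefinite Gram matrix (`exists_gramCoeff_eq`). The Gram entries become extra
SDP variables.

The Gram theorem is proved by duality. The cone of matrices with a Gram representation is closed, so
a matrix outside it is separated by a linear functional. Slightly perturbed, this functional has a
positive definite block Hankel matrix, hence a quadrature rule (`exists_quadrature`), which
evaluates any matrix that is positive semidefinite on the line to a non-negative number: a
contradiction.

Restriction. The polynomial pieces glue to a continuous cone-valued curve Y with Y_L(x) = Y_L(0) +
∫₀ˣ A Y. Take as level l moment for g the l-fold integral of g Y from 0. The product rule for g Y_L,
integrated repeatedly, gives the Γ equations; Ω is an iterated integral of increments of ∫ g Y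
(`omegaMap_eq`), and the cone is stable under integration and non-negative scaling
(`exists_boundingSDP_feasible`). -/

namespace MomentBounds

/-! ## Gram representations of positive semidefinite polynomial matrices -/

section Gram

open Matrix

theorem _root_.Matrix.PosSemidef.exists_eq_transpose_mul_self {n : Type*} [Fintype n]
    [DecidableEq n] {A : Matrix n n ℝ} (h : A.PosSemidef) : ∃ B : Matrix n n ℝ, A = Bᵀ * B := by
  open scoped MatrixOrder in
  obtain ⟨B, hB⟩ := CStarAlgebra.nonneg_iff_eq_star_mul_self.1 (Matrix.nonneg_iff_posSemidef.2 h)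
  exact ⟨B, by simpa [star_eq_conjTranspose, conjTranspose_eq_transpose_of_trivial] using hB⟩

/-- Real symmetric matrices are orthogonally diagonalizable. -/
theorem _root_.Matrix.IsSymm.exists_pow_eq {n : Type*} [Fintype n] [DecidableEq n]
    {N : Matrix n n ℝ} (h : N.IsSymm) :
    ∃ (U : Matrix n n ℝ) (μ : n → ℝ), ∀ k : ℕ, N ^ k = U * diagonal (fun i => μ i ^ k) * Uᵀ := by
  have hN : N.IsHermitian := by
    rwa [IsHermitian, conjTranspose_eq_transpose_of_trivial]
  refine ⟨hN.eigenvectorUnitary, hN.eigenvalues, fun k => ?_⟩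
  have h1 := hN.spectral_theorem
  have h2 : (N ^ k) = _ := congrArg (· ^ k) h1
  rw [← map_pow, Unitary.conjStarAlgAut_apply] at h2
  rw [h2, diagonal_pow, star_eq_conjTranspose, conjTranspose_eq_transpose_of_trivial]
  rfl

/-- A sequence of symmetric matrices whose block Hankel matrix is positive definite has a
quadrature rule. -/
theorem exists_quadrature {J : Type*} [Fintype J] [DecidableEq J] (e : ℕ) (s : ℕ → J → J → ℝ) (hs : ∀ k i j, s k i j = s k j i)
    (hH : (Matrix.of fun p q : J × Fin (e + 1) => s (p.2 + q.2) p.1 q.1).PosDef) :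
    ∃ (μ : J × Fin (e + 1) → ℝ) (w : J × Fin (e + 1) → J → ℝ),
      ∀ k ≤ 2 * e, ∀ i j, s k i j = ∑ p, μ p ^ k * (w p i * w p j) := by
  obtain ⟨B, hB⟩ := hH.posSemidef.exists_eq_transpose_mul_self
  have hBu : IsUnit B := by
    have h1 := hH.isUnit
    rw [hB, Matrix.isUnit_iff_isUnit_det, det_mul, det_transpose] at h1
    exact (Matrix.isUnit_iff_isUnit_det _).2 (isUnit_of_mul_isUnit_left h1)
  have hBd : IsUnit B.det := (Matrix.isUnit_iff_isUnit_det _).1 hBu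
  have hBt : IsUnit Bᵀ.det := by rwa [det_transpose]
  -- The shifted Hankel matrix. Its corner contains `s (2 * e + 1)`, which the original matrix does
  -- not see; any symmetric value will do there.
  set H' : Matrix (J × Fin (e + 1)) (J × Fin (e + 1)) ℝ :=
    Matrix.of fun p q => s (p.2 + q.2 + 1) p.1 q.1 with hH'
  have hH's : H'ᵀ = H' := by
    ext p q
    simp only [hH', transpose_apply, of_apply]
    rw [hs, add_comm (q.2 : ℕ)]
  -- `N` plays the role of multiplication by the variable: it is symmetric for the inner product
  -- defined by the Hankel matrix.
  set N := Bᵀ⁻¹ * H' * B⁻¹ with hN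
  have hNs : N.IsSymm := by
    rw [IsSymm, hN, transpose_mul, transpose_mul, hH's, transpose_nonsing_inv,
      transpose_nonsing_inv, transpose_transpose, mul_assoc]
  have hNB : Bᵀ * (N * B) = H' := by
    rw [hN, mul_assoc, mul_assoc, nonsing_inv_mul _ hBd, mul_one, mul_nonsing_inv_cancel_left _ _ hBt]
  -- Column (j, b) of `H'` is column (j, b + 1) of the Hankel matrix, and `Bᵀ` can be cancelled; so
  -- `N` advances the columns of `B`.
  have hcol : ∀ (b : ℕ) (hb : b < e + 1) (j : J),
      (fun p => B p (j, ⟨b, hb⟩)) = (N ^ b) *ᵥ (fun p => B p (j, 0)) := by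
    intro b
    induction b with
    | zero => intro hb j; simp
    | succ b ih =>
      intro hb j
      rw [pow_succ', ← mulVec_mulVec, ← ih (by omega) j]
      have h1 : Bᵀ *ᵥ (fun p => B p (j, ⟨b + 1, hb⟩))
          = Bᵀ *ᵥ (N *ᵥ fun p => B p (j, ⟨b, by omega⟩)) := by
        have h2 : ∀ (M : Matrix (J × Fin (e + 1)) (J × Fin (e + 1)) ℝ) q,
            M *ᵥ (fun p => B p q) = fun p => (M * B) p q := fun M q => rfl
        rw [h2 N, h2 Bᵀ, ← hB]
        have h3 : Bᵀ *ᵥ (fun p => (N * B) p (j, ⟨b, by omega⟩))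
          = fun p => (Bᵀ * (N * B)) p (j, ⟨b, by omega⟩) := rfl
        rw [h3, hNB]
        ext p
        simp [hH', add_assoc]
      have h4 := congrArg (fun v => Bᵀ⁻¹ *ᵥ v) h1
      simpa [mulVec_mulVec, nonsing_inv_mul_cancel_left _ _ hBt, nonsing_inv_mul _ hBt] using h4
  obtain ⟨U, μ, hU⟩ := hNs.exists_pow_eq
  refine ⟨μ, fun p i => (Uᵀ *ᵥ (fun p => B p (i, 0))) p, fun k hk i j => ?_⟩
  -- Both summands are at most e, so `s k` is an entry of the Hankel matrix, that is, an inner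
  -- product of N^a u_i and N^b u_j. Diagonalizing N^(a+b) gives nodes and weights.
  obtain ⟨a, b, ha, hb, rfl⟩ : ∃ a b, a < e + 1 ∧ b < e + 1 ∧ k = a + b :=
    ⟨min k e, k - min k e, by omega, by omega, by omega⟩
  have h1 : s (a + b) i j = (fun p => B p (i, ⟨a, ha⟩)) ⬝ᵥ (fun p => B p (j, ⟨b, hb⟩)) := by
    have := congrFun (congrFun hB (i, ⟨a, ha⟩)) (j, ⟨b, hb⟩)
    simpa [mul_apply, dotProduct] using this
  have hsym : (N ^ b)ᵀ = N ^ b := by rw [transpose_pow, hNs.eq]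
  set u : J → J × Fin (e + 1) → ℝ := fun i p => B p (i, 0)
  have h2 : s (a + b) i j = (N ^ a *ᵥ u i) ⬝ᵥ (N ^ b *ᵥ u j) := by rw [h1, hcol a ha, hcol b hb]
  rw [h2, dotProduct_mulVec, ← mulVec_transpose, hsym, mulVec_mulVec,
    ← pow_add, add_comm b a, hU, ← mulVec_mulVec, ← mulVec_mulVec, dotProduct_comm,
    dotProduct_mulVec, ← mulVec_transpose]
  simp only [dotProduct, mulVec_diagonal]
  exact Finset.sum_congr rfl fun p _ => by ring

open Filter Topology

theorem _root_.Matrix.posSemidef_iff_sum_nonneg {n : Type*} [Fintype n] {M : Matrix n n ℝ} :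
    M.PosSemidef ↔ (∀ i j, M i j = M j i) ∧ ∀ x : n → ℝ, 0 ≤ ∑ i, ∑ j, x i * M i j * x j := by
  rw [posSemidef_iff_dotProduct_mulVec]
  refine and_congr ?_ (forall_congr' fun x => ?_)
  · rw [IsHermitian, conjTranspose_eq_transpose_of_trivial, ← Matrix.ext_iff]
    exact ⟨fun h i j => (h j i), fun h i j => (h j i)⟩
  · simp [dotProduct, mulVec, Finset.mul_sum, mul_assoc]

theorem _root_.Matrix.posDef_of_sum_pos {n : Type*} [Fintype n] {M : Matrix n n ℝ}
    (h : ∀ i j, M i j = M j i) (h' : ∀ x : n → ℝ, x ≠ 0 → 0 < ∑ i, ∑ j, x i * M i j * x j) :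
    M.PosDef := by
  refine PosDef.of_dotProduct_mulVec_pos ?_ fun x hx => ?_
  · rw [IsHermitian, conjTranspose_eq_transpose_of_trivial, ← Matrix.ext_iff]
    exact fun i j => h j i
  · simpa [dotProduct, mulVec, Finset.mul_sum, mul_assoc] using h' x hx

/-- In a factorization BᵀB the diagonal entry is the squared norm of a column of B, so that column
vanishes. -/
theorem _root_.Matrix.PosSemidef.apply_eq_zero_of_diag {n : Type*} [Fintype n] [DecidableEq n]
    {M : Matrix n n ℝ} (hM : M.PosSemidef) {i : n} (h : M i i = 0) (j : n) :
    M i j = 0 ∧ M j i = 0 := by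
  obtain ⟨B, rfl⟩ := hM.exists_eq_transpose_mul_self
  have h0 : ∀ k, B k i = 0 := by
    simp only [mul_apply, transpose_apply] at h
    rw [Finset.sum_eq_zero_iff_of_nonneg fun k _ => mul_self_nonneg _] at h
    exact fun k => mul_self_eq_zero.1 (h k (Finset.mem_univ k))
  simp [mul_apply, h0]

/-- The image of a closed cone under a linear map that is injective at the apex is closed. -/
theorem isClosed_image_of_cone {E F : Type*} [NormedAddCommGroup E] [NormedSpace ℝ E]
    [FiniteDimensional ℝ E] [NormedAddCommGroup F] [NormedSpace ℝ F] {C : Set E}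
    (hC : IsClosed C) (hsmul : ∀ c : ℝ, 0 ≤ c → ∀ x ∈ C, c • x ∈ C) (T : E →L[ℝ] F)
    (hT : ∀ x ∈ C, T x = 0 → x = 0) : IsClosed (T '' C) := by
  have : ProperSpace E := FiniteDimensional.proper ℝ E
  have hK : IsCompact (Metric.sphere (0 : E) 1 ∩ C) := (isCompact_sphere _ _).inter_right hC
  -- By compactness ‖T x‖ has a positive minimum on the unit vectors of `C`; homogeneity extends the
  -- bound to all of `C`.
  obtain ⟨δ, hδ, hb⟩ : ∃ δ > 0, ∀ x ∈ C, δ * ‖x‖ ≤ ‖T x‖ := by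
    obtain ⟨δ, hδ, hb⟩ : ∃ δ > 0, ∀ x ∈ Metric.sphere (0 : E) 1 ∩ C, δ ≤ ‖T x‖ := by
      rcases (Metric.sphere (0 : E) 1 ∩ C).eq_empty_or_nonempty with h | h
      · exact ⟨1, one_pos, by simp [h]⟩
      · obtain ⟨x, hx, hmin⟩ := hK.exists_isMinOn h (by fun_prop : ContinuousOn (fun x => ‖T x‖) _)
        refine ⟨‖T x‖, norm_pos_iff.2 fun h0 => ?_, fun y hy => hmin hy⟩
        have h1 := hT x hx.2 h0
        simp [h1] at hx
    refine ⟨δ, hδ, fun x hx => ?_⟩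
    rcases eq_or_ne x 0 with rfl | h0
    · simp
    · have hn : 0 < ‖x‖ := norm_pos_iff.2 h0
      have h1 := hb (‖x‖⁻¹ • x) ⟨by simp [norm_smul, hn.ne'], hsmul _ (by positivity) _ hx⟩
      rw [map_smul, norm_smul, norm_inv, norm_norm] at h1
      calc δ * ‖x‖ ≤ (‖x‖⁻¹ * ‖T x‖) * ‖x‖ := by gcongr
        _ = ‖T x‖ := by field_simp
  refine isSeqClosed_iff_isClosed.1 fun u y hu hy => ?_
  choose x hxC hxu using hu
  -- A convergent sequence of images is bounded, so the lower bound on `T` confines the preimages to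
  -- a compact set.
  obtain ⟨M, hM⟩ := hy.norm.bddAbove_range
  have hx : ∀ n, x n ∈ Metric.closedBall (0 : E) (M / δ) ∩ C := fun n => by
    refine ⟨?_, hxC n⟩
    rw [mem_closedBall_zero_iff, le_div_iff₀ hδ, mul_comm]
    exact (hb _ (hxC n)).trans (by rw [hxu]; exact hM ⟨n, rfl⟩)
  obtain ⟨a, ha, φ, hφ, hlim⟩ :=
    ((isCompact_closedBall (0 : E) (M / δ)).inter_right hC).tendsto_subseq hx
  refine ⟨a, ha.2, tendsto_nhds_unique ((T.continuous.tendsto a).comp hlim) ?_⟩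
  have : (T ∘ x ∘ φ) = u ∘ φ := by funext n; simp [hxu]
  rw [this]
  exact hy.comp hφ.tendsto_atTop

/-- The coefficients of the polynomial matrix with Gram matrix `Q`. -/
def gramCoeff (J : Type*) (e : ℕ) : (J × Fin (e + 1) → J × Fin (e + 1) → ℝ) →ₗ[ℝ]
    (Fin (2 * e + 1) → J → J → ℝ) where
  toFun Q k i j := ∑ a : Fin (e + 1), ∑ b : Fin (e + 1),
    if (a : ℕ) + b = k then Q (i, a) (j, b) else 0
  map_add' Q Q' := by
    funext k i j
    simp only [Pi.add_apply, ← Finset.sum_add_distrib]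
    refine Finset.sum_congr rfl fun a _ => Finset.sum_congr rfl fun b _ => ?_
    split_ifs <;> simp
  map_smul' c Q := by
    funext k i j
    simp [Finset.mul_sum]

theorem gramCoeff_apply {J : Type*} (e : ℕ) (Q : J × Fin (e + 1) → J × Fin (e + 1) → ℝ) (k i j) :
    gramCoeff J e Q k i j = ∑ a : Fin (e + 1), ∑ b : Fin (e + 1),
      if (a : ℕ) + b = k then Q (i, a) (j, b) else 0 := rfl

/-- With `c k = x ^ k` this evaluates the polynomial matrix at x; with `c` a moment sequence it
produces a Hankel form. -/
theorem sum_gramCoeff_mul {J : Type*} (e : ℕ) (Q : J × Fin (e + 1) → J × Fin (e + 1) → ℝ) (c : ℕ → ℝ) (i j) :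
    ∑ k, gramCoeff J e Q k i j * c k
      = ∑ a : Fin (e + 1), ∑ b : Fin (e + 1), Q (i, a) (j, b) * c (a + b) := by
  simp only [gramCoeff_apply, Finset.sum_mul]
  rw [Finset.sum_comm]
  refine Finset.sum_congr rfl fun a _ => ?_
  rw [Finset.sum_comm]
  refine Finset.sum_congr rfl fun b _ => ?_
  rw [Finset.sum_eq_single (⟨a + b, by omega⟩ : Fin (2 * e + 1))]
  · simp
  · intro k _ hk
    rw [if_neg fun h => hk (Fin.ext h.symm), zero_mul]
  · simp

/-- This injectivity at the apex makes the cone of Gram-representable matrices closed. The diagonal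
coefficient of degree 2a is the diagonal entry at a plus entries at b ≠ c with b + c = 2a. One of b,
c is below a, so by induction its row or column already vanishes. -/
theorem gramCoeff_eq_zero {J : Type*} [Fintype J] [DecidableEq J] (e : ℕ) (Q : J × Fin (e + 1) → J × Fin (e + 1) → ℝ)
    (hQ : (Matrix.of Q).PosSemidef) (h : gramCoeff J e Q = 0) : Q = 0 := by
  have key : ∀ (a : ℕ) (ha : a < e + 1) (i : J), Q (i, ⟨a, ha⟩) (i, ⟨a, ha⟩) = 0 := by
    intro a
    induction a using Nat.strong_induction_on with
    | _ a ih =>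
      intro ha i
      have h1 := congrFun (congrFun (congrFun h ⟨2 * a, by omega⟩) i) i
      rw [gramCoeff_apply, Finset.sum_eq_single ⟨a, ha⟩, Finset.sum_eq_single ⟨a, ha⟩] at h1
      · simpa [two_mul] using h1
      · intro b _ hb
        rw [if_neg]
        intro h2
        exact hb (Fin.ext (by simp at h2 ⊢; omega))
      · simp
      · intro b _ hb
        refine Finset.sum_eq_zero fun c _ => ?_
        split_ifs with h2
        · simp only at h2
          have hne : (b : ℕ) ≠ a := fun h3 => hb (Fin.ext h3)
          rcases lt_or_gt_of_ne hne with h3 | h3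
          · exact (hQ.apply_eq_zero_of_diag (ih b h3 b.2 i) (i, c)).1
          · exact (hQ.apply_eq_zero_of_diag (ih c (by omega) c.2 i) (i, b)).2
        · rfl
      · simp
  funext p q
  exact (hQ.apply_eq_zero_of_diag (key p.2 p.2.2 p.1) q).1

theorem isClosed_setOf_posSemidef (n : Type*) [Fintype n] :
    IsClosed {Q : n → n → ℝ | (Matrix.of Q).PosSemidef} := by
  simp only [Matrix.posSemidef_iff_sum_nonneg, Set.ofPred_and, Set.ofPred_forall, of_apply]
  refine IsClosed.inter ?_ ?_
  · exact isClosed_iInter fun i => isClosed_iInter fun j =>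
      isClosed_eq (by fun_prop) (by fun_prop)
  · exact isClosed_iInter fun x => isClosed_le continuous_const (by fun_prop)

/-- The cone of the coefficient sequences of polynomial matrices with a Gram representation. -/
def gramCone (J : Type*) [Fintype J] [DecidableEq J] (e : ℕ) :
    ProperCone ℝ (Fin (2 * e + 1) → J → J → ℝ) where
  carrier := gramCoeff J e '' {Q | (Matrix.of Q).PosSemidef}
  add_mem' := by
    rintro _ _ ⟨Q, hQ, rfl⟩ ⟨Q', hQ', rfl⟩
    exact ⟨Q + Q', PosSemidef.add hQ hQ', map_add _ _ _⟩
  zero_mem' := ⟨0, PosSemidef.zero, map_zero _⟩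
  smul_mem' := by
    rintro c _ ⟨Q, hQ, rfl⟩
    exact ⟨(c : ℝ) • Q, PosSemidef.smul hQ c.2, map_smul _ _ _⟩
  isClosed' := isClosed_image_of_cone (C := {Q | (Matrix.of Q).PosSemidef})
    (isClosed_setOf_posSemidef _) (fun c hc x hx => show (Matrix.of (c • x)).PosSemidef from
      PosSemidef.smul (x := Matrix.of x) hx hc)
    (LinearMap.toContinuousLinearMap (gramCoeff J e)) fun x hx h => gramCoeff_eq_zero e x hx h

variable {J : Type*} [Fintype J] [DecidableEq J]

theorem sum_apply_single {e : ℕ} (ℓ : (Fin e → J → J → ℝ) →ₗ[ℝ] ℝ) (G : Fin e → J → J → ℝ) :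
    ℓ G = ∑ k, ∑ i, ∑ j, G k i j * ℓ (Pi.single k (Pi.single i (Pi.single j 1))) := by
  have hG : G = ∑ k, ∑ i, ∑ j, G k i j • (Pi.single k (Pi.single i (Pi.single j (1 : ℝ)))) := by
    funext k i j
    simp [Finset.sum_apply, Pi.single_apply, Finset.sum_ite_eq, ite_apply]
  conv_lhs => rw [hG]
  simp [map_sum]

/-- A symmetric polynomial matrix of degree at most `2 * e` that is positive semidefinite on the
real line has a Gram matrix. -/
theorem exists_gramCoeff_eq (e : ℕ) (F : Fin (2 * e + 1) → J → J → ℝ)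
    (hs : ∀ k i j, F k i j = F k j i)
    (hF : ∀ x : ℝ, (Matrix.of fun i j => ∑ k, F k i j * x ^ (k : ℕ)).PosSemidef) :
    ∃ Q : J × Fin (e + 1) → J × Fin (e + 1) → ℝ, (Matrix.of Q).PosSemidef ∧ gramCoeff J e Q = F := by
  by_contra hn
  -- `ℓ` is non-negative on the cone and negative at `F`.
  obtain ⟨ℓ, hℓ, hℓF⟩ := ProperCone.hyperplane_separation_point (gramCone J e) (x₀ := F)
    fun ⟨Q, hQ, h⟩ => hn ⟨Q, hQ, h⟩
  set E : Fin (2 * e + 1) → J → J → (Fin (2 * e + 1) → J → J → ℝ) :=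
    fun k i j => Pi.single k (Pi.single i (Pi.single j 1)) with hE
  -- The moment sequence of `ℓ`, symmetrized in i and j; symmetrizing without halving causes the
  -- factor 2 in `hpair`. The value 0 beyond degree 2e is never paired with `F`.
  set s₀ : ℕ → J → J → ℝ := fun k i j =>
    if h : k < 2 * e + 1 then ℓ (E ⟨k, h⟩ i j) + ℓ (E ⟨k, h⟩ j i) else 0 with hs₀
  -- Moments of the counting measure on {0, …, e} times the identity matrix. These e + 1 nodes
  -- detect every nonzero polynomial of degree at most e, so the Hankel form is positive definite.
  set s₁ : ℕ → J → J → ℝ := fun k i j =>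
    if i = j then ∑ x ∈ Finset.range (e + 1), (x : ℝ) ^ k else 0 with hs₁
  have hpair : ∀ G : Fin (2 * e + 1) → J → J → ℝ, (∀ k i j, G k i j = G k j i) →
      ∑ k, ∑ i, ∑ j, G k i j * s₀ k i j = 2 * ℓ G := by
    intro G hG
    have h1 := sum_apply_single (ℓ : (Fin (2 * e + 1) → J → J → ℝ) →ₗ[ℝ] ℝ) G
    have h2 : ∑ k, ∑ i, ∑ j, G k i j * ℓ (E k j i) = ∑ k, ∑ i, ∑ j, G k i j * ℓ (E k i j) := by
      refine Finset.sum_congr rfl fun k _ => ?_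
      rw [Finset.sum_comm]
      exact Finset.sum_congr rfl fun i _ => Finset.sum_congr rfl fun j _ => by rw [hG]
    simp only [ContinuousLinearMap.coe_coe] at h1
    simp only [hs₀, Fin.is_lt, dif_pos, Fin.eta, mul_add, Finset.sum_add_distrib, h2]
    rw [h1, ← two_mul]
  -- The Hankel form at v is the pairing of the moments with the polynomial matrix whose Gram matrix
  -- is the rank one matrix v vᵀ.
  have hquad : ∀ (s : ℕ → J → J → ℝ) (v : J × Fin (e + 1) → ℝ),
      ∑ p, ∑ q, v p * s (p.2 + q.2) p.1 q.1 * v q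
        = ∑ k, ∑ i, ∑ j, gramCoeff J e (fun p q => v p * v q) k i j * s k i j := by
    intro s v
    have h1 : ∑ k, ∑ i, ∑ j, gramCoeff J e (fun p q => v p * v q) k i j * s k i j
        = ∑ i, ∑ j, ∑ k, gramCoeff J e (fun p q => v p * v q) k i j * s k i j := by
      rw [Finset.sum_comm]
      exact Finset.sum_congr rfl fun i _ => Finset.sum_comm
    rw [h1]
    simp only [Fintype.sum_prod_type]
    refine Finset.sum_congr rfl fun i _ => ?_
    rw [Finset.sum_comm]
    refine Finset.sum_congr rfl fun j _ => ?_
    rw [sum_gramCoeff_mul e _ (fun k => s k i j)]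
    exact Finset.sum_congr rfl fun a _ => Finset.sum_congr rfl fun b _ => by ring
  have hq₀ : ∀ v : J × Fin (e + 1) → ℝ, 0 ≤ ∑ p, ∑ q, v p * s₀ (p.2 + q.2) p.1 q.1 * v q := by
    intro v
    rw [hquad, hpair]
    · have : gramCoeff J e (fun p q => v p * v q) ∈ gramCone J e := by
        refine ⟨_, ?_, rfl⟩
        simpa using! posSemidef_vecMulVec_self_star v
      have := hℓ _ this
      positivity
    · intro k i j
      rw [gramCoeff_apply, gramCoeff_apply, Finset.sum_comm]
      refine Finset.sum_congr rfl fun a _ => Finset.sum_congr rfl fun b _ => ?_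
      rw [add_comm (a : ℕ), mul_comm (v _)]
  have hq₁ : ∀ v : J × Fin (e + 1) → ℝ, v ≠ 0 →
      0 < ∑ p, ∑ q, v p * s₁ (p.2 + q.2) p.1 q.1 * v q := by
    intro v hv
    have h1 : ∑ p, ∑ q, v p * s₁ (p.2 + q.2) p.1 q.1 * v q
        = ∑ i, ∑ x ∈ Finset.range (e + 1), (∑ a, v (i, a) * (x : ℝ) ^ (a : ℕ)) ^ 2 := by
      simp only [Fintype.sum_prod_type, hs₁]
      refine Finset.sum_congr rfl fun i _ => ?_
      simp only [sq, Finset.sum_mul_sum]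
      rw [Finset.sum_comm (s := Finset.range (e + 1))]
      refine Finset.sum_congr rfl fun a _ => ?_
      rw [Finset.sum_eq_single i]
      · rw [Finset.sum_comm]
        refine Finset.sum_congr rfl fun b _ => ?_
        simp only [if_true, Finset.mul_sum, Finset.sum_mul]
        exact Finset.sum_congr rfl fun x _ => by ring
      · intro j _ hj
        simp [hj.symm]
      · simp
    rw [h1]
    obtain ⟨⟨i, a⟩, hia⟩ := Function.ne_iff.1 hv
    have h2 : 0 ≤ ∑ i, ∑ x ∈ Finset.range (e + 1), (∑ a, v (i, a) * (x : ℝ) ^ (a : ℕ)) ^ 2 :=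
      Finset.sum_nonneg fun i _ => Finset.sum_nonneg fun x _ => sq_nonneg _
    refine lt_of_le_of_ne h2 fun h3 => hia ?_
    have h4 := (Finset.sum_eq_zero_iff_of_nonneg fun i _ =>
      Finset.sum_nonneg fun x _ => sq_nonneg _).1 h3.symm i (Finset.mem_univ _)
    have h5 := (Finset.sum_eq_zero_iff_of_nonneg fun x _ => sq_nonneg _).1 h4
    set P : Polynomial ℝ := ∑ a : Fin (e + 1), Polynomial.monomial (a : ℕ) (v (i, a)) with hP
    have hP0 : P = 0 := by
      refine Polynomial.eq_zero_of_natDegree_lt_card_of_eval_eq_zero P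
        (f := fun x : Fin (e + 1) => ((x : ℕ) : ℝ)) ?_ ?_ ?_
      · exact fun x y hxy => Fin.ext (Nat.cast_injective hxy)
      · intro x
        have := h5 x (Finset.mem_range.2 x.2)
        simpa [hP, Polynomial.eval_finsetSum] using this
      · rw [Fintype.card_fin, Nat.lt_succ_iff]
        refine Polynomial.natDegree_sum_le_of_forall_le _ _ fun a _ => ?_
        exact (Polynomial.natDegree_monomial_le _).trans (Nat.lt_succ_iff.1 a.2)
    have h6 := congrArg (fun p => Polynomial.coeff p a) hP0
    simpa [hP, Polynomial.finsetSum_coeff, Polynomial.coeff_monomial, Fin.val_inj] using h6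
  set M := ∑ k, ∑ i, ∑ j, F k i j * s₁ k i j with hM
  -- Small enough that the perturbed pairing with `F`, namely 2 ℓ F + ε M, is still negative; the 1
  -- keeps the denominator positive.
  set ε : ℝ := -ℓ F / (|M| + 1) with hε
  have hε0 : 0 < ε := div_pos (by linarith) (by positivity)
  have hεM : ε * M < -ℓ F * 2 := by
    have h1 : ε * M ≤ ε * (|M| + 1) := by
      gcongr
      linarith [le_abs_self M]
    have h2 : ε * (|M| + 1) = -ℓ F := by rw [hε]; field_simp
    linarith
  obtain ⟨μ, w, hw⟩ := exists_quadrature (J := J) e (fun k i j => s₀ k i j + ε * s₁ k i j)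
    (by
      intro k i j
      simp only [hs₀, hs₁, eq_comm (a := i)]
      split_ifs <;> ring)
    (by
      refine posDef_of_sum_pos ?_ ?_
      · intro p q
        simp only [of_apply, hs₀, hs₁, add_comm (p.2 : ℕ), eq_comm (a := p.1)]
        split_ifs <;> ring
      · intro v hv
        have h1 := hq₀ v
        have h2 := mul_pos hε0 (hq₁ v hv)
        have h3 : ∑ p, ∑ q, v p * (Matrix.of fun p q : J × Fin (e + 1) =>
            s₀ (p.2 + q.2) p.1 q.1 + ε * s₁ (p.2 + q.2) p.1 q.1) p q * v q
            = ∑ p, ∑ q, v p * s₀ (p.2 + q.2) p.1 q.1 * v q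
              + ε * ∑ p, ∑ q, v p * s₁ (p.2 + q.2) p.1 q.1 * v q := by
          simp only [Finset.mul_sum, ← Finset.sum_add_distrib, of_apply]
          exact Finset.sum_congr rfl fun p _ => Finset.sum_congr rfl fun q _ => by ring
        rw [h3]
        linarith)
  have h1 : ∑ k, ∑ i, ∑ j, F k i j * (s₀ k i j + ε * s₁ k i j) = 2 * ℓ F + ε * M := by
    rw [← hpair F hs, hM]
    simp only [Finset.mul_sum, ← Finset.sum_add_distrib]
    exact Finset.sum_congr rfl fun k _ => Finset.sum_congr rfl fun i _ =>
      Finset.sum_congr rfl fun j _ => by ring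
  -- The quadrature rule turns the pairing into a sum of values of the quadratic forms of `F` at the
  -- nodes, each non-negative by hypothesis.
  have h2 : ∑ k, ∑ i, ∑ j, F k i j * (s₀ k i j + ε * s₁ k i j)
      = ∑ p, ∑ i, ∑ j, w p i * (∑ k, F k i j * μ p ^ (k : ℕ)) * w p j := by
    have h3 : ∀ (k : Fin (2 * e + 1)) i j, s₀ k i j + ε * s₁ k i j = _ :=
      fun k i j => hw k (by omega) i j
    simp only [h3, Finset.mul_sum, Finset.sum_mul]
    rw [Finset.sum_comm, Finset.sum_comm (s := (Finset.univ : Finset (J × Fin (e + 1))))]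
    refine Finset.sum_congr rfl fun i _ => ?_
    rw [Finset.sum_comm, Finset.sum_comm (s := (Finset.univ : Finset (J × Fin (e + 1))))]
    refine Finset.sum_congr rfl fun j _ => ?_
    rw [Finset.sum_comm]
    exact Finset.sum_congr rfl fun p _ => Finset.sum_congr rfl fun k _ => by ring
  have h3 : 0 ≤ ∑ p, ∑ i, ∑ j, w p i * (∑ k, F k i j * μ p ^ (k : ℕ)) * w p j :=
    Finset.sum_nonneg fun p _ => (posSemidef_iff_sum_nonneg.1 (hF (μ p))).2 (w p)
  linarith

end Gram

/-! ### Positive semidefinite polynomial matrices on an interval -/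

section IntervalGram

open Matrix Polynomial

variable {J : Type*} [Fintype J] [DecidableEq J]

/-- A symmetric polynomial matrix is positive semidefinite on `[a, b]` if and only if its
pullback to the real line along `x ↦ (a + b x²) / (1 + x²)` has a Gram matrix, after
denominators are cleared. -/
theorem posSemidef_on_Icc_iff (d : ℕ) {a b : ℝ} (hab : a < b) (P : J → J → ℝ[X])
    (hdeg : ∀ i j, (P i j).natDegree ≤ d) (hsymm : ∀ i j, P i j = P j i) :
    (∀ s ∈ Set.Icc a b, (Matrix.of fun i j => (P i j).eval s).PosSemidef) ↔
      ∃ Q : Matrix (J × Fin (d + 1)) (J × Fin (d + 1)) ℝ, Q.PosSemidef ∧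
        ∀ (x : ℝ) i j, (1 + x ^ 2) ^ d * (P i j).eval ((a + b * x ^ 2) / (1 + x ^ 2))
          = ∑ k : Fin (d + 1), ∑ l : Fin (d + 1), Q (i, k) (j, l) * x ^ (k + l : ℕ) := by
  constructor
  · intro h
    -- Each monomial of degree k is homogenized to degree d before the substitution, so `G` is a
    -- polynomial of degree at most 2d.
    set G : J → J → ℝ[X] := fun i j => ∑ k ∈ Finset.range (d + 1),
      C ((P i j).coeff k) * ((C a + C b * X ^ 2) ^ k * (1 + X ^ 2) ^ (d - k)) with hG
    have hGe : ∀ i j x, (G i j).eval x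
        = (1 + x ^ 2) ^ d * (P i j).eval ((a + b * x ^ 2) / (1 + x ^ 2)) := by
      intro i j x
      rw [eval_eq_sum_range' (Nat.lt_succ_iff.2 (hdeg i j)), Finset.mul_sum, hG, eval_finsetSum]
      refine Finset.sum_congr rfl fun k hk => ?_
      have hx : (1 + x ^ 2) ≠ 0 := by positivity
      have hk' : k ≤ d := Nat.lt_succ_iff.1 (Finset.mem_range.1 hk)
      obtain ⟨r, rfl⟩ := Nat.exists_eq_add_of_le hk'
      simp only [eval_mul, eval_C, eval_pow, eval_add, eval_X, eval_one, Nat.add_sub_cancel_left]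
      rw [div_pow, pow_add]
      field_simp
    have hGd : ∀ i j, (G i j).natDegree < 2 * d + 1 := by
      intro i j
      refine Nat.lt_succ_iff.2 (natDegree_sum_le_of_forall_le _ _ fun k hk => ?_)
      have hk' : k ≤ d := Nat.lt_succ_iff.1 (Finset.mem_range.1 hk)
      have h1 : ((C a + C b * X ^ 2 : ℝ[X]) ^ k).natDegree ≤ k * 2 :=
        natDegree_pow_le_of_le k (by compute_degree)
      have h2 : ((1 + X ^ 2 : ℝ[X]) ^ (d - k)).natDegree ≤ (d - k) * 2 :=
        natDegree_pow_le_of_le _ (by compute_degree)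
      refine (natDegree_C_mul_le _ _).trans ((natDegree_mul_le_of_le h1 h2).trans (by omega))
    have hGs : ∀ i j (x : ℝ),
        ∑ k : Fin (2 * d + 1), (G i j).coeff k * x ^ (k : ℕ) = (G i j).eval x := by
      intro i j x
      rw [eval_eq_sum_range' (hGd i j), Finset.sum_range]
    obtain ⟨Q, hQ, hQG⟩ := exists_gramCoeff_eq d (fun k i j => (G i j).coeff k)
      (fun k i j => by simp only [hG, hsymm i j]) fun x => by
        have hx : 0 < 1 + x ^ 2 := by positivity
        have hmem : (a + b * x ^ 2) / (1 + x ^ 2) ∈ Set.Icc a b := by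
          constructor
          · rw [le_div_iff₀ hx]; nlinarith [mul_nonneg (sub_nonneg.2 hab.le) (sq_nonneg x)]
          · rw [div_le_iff₀ hx]; nlinarith
        convert! (h _ hmem).smul (pow_pos hx d).le using 1
        ext i j
        simp [hGs, hGe]
    refine ⟨Matrix.of Q, hQ, fun x i j => ?_⟩
    rw [← hGe, ← hGs]
    have h1 := sum_gramCoeff_mul d Q (fun k => x ^ k) i j
    rw [hQG] at h1
    exact h1
  · rintro ⟨Q, hQ, h⟩
    -- The substitution never attains the endpoint b; positivity there follows from that on [a, b)
    -- by closedness.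
    have hcl : IsClosed {s : ℝ | (Matrix.of fun i j => (P i j).eval s).PosSemidef} :=
      (isClosed_setOf_posSemidef J).preimage (f := fun s i j => (P i j).eval s) (by fun_prop)
    have hsub : Set.Ico a b ⊆ {s : ℝ | (Matrix.of fun i j => (P i j).eval s).PosSemidef} := by
      rintro s ⟨hs1, hs2⟩
      set x := Real.sqrt ((s - a) / (b - s)) with hx
      have hbs : 0 < b - s := sub_pos.2 hs2
      have hx2 : x ^ 2 = (s - a) / (b - s) :=
        Real.sq_sqrt (div_nonneg (sub_nonneg.2 hs1) hbs.le)
      have hxs : (a + b * x ^ 2) / (1 + x ^ 2) = s := by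
        have h1 : 1 + x ^ 2 ≠ 0 := by positivity
        rw [div_eq_iff h1, hx2]
        field_simp
        ring
      have hpos : 0 < (1 + x ^ 2) ^ d := by positivity
      refine posSemidef_iff_sum_nonneg.2 ⟨fun i j => by simp [hsymm i j], fun v => ?_⟩
      -- The Gram form at v ⊗ (1, x, …, x^d) is the form of the polynomial matrix at v, up to a
      -- positive factor.
      have h1 := (posSemidef_iff_sum_nonneg.1 hQ).2 fun p => v p.1 * x ^ (p.2 : ℕ)
      have h2 : ∑ p, ∑ q, v p.1 * x ^ (p.2 : ℕ) * Q p q * (v q.1 * x ^ (q.2 : ℕ))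
          = (1 + x ^ 2) ^ d * ∑ i, ∑ j, v i * (P i j).eval s * v j := by
        simp only [Fintype.sum_prod_type, Finset.mul_sum]
        refine Finset.sum_congr rfl fun i _ => ?_
        rw [Finset.sum_comm]
        refine Finset.sum_congr rfl fun j _ => ?_
        have h3 := h x i j
        rw [hxs] at h3
        calc _ = v i * v j * ∑ k : Fin (d + 1), ∑ l : Fin (d + 1),
              Q (i, k) (j, l) * x ^ (k + l : ℕ) := by
              simp only [Finset.mul_sum, pow_add]
              exact Finset.sum_congr rfl fun k _ => Finset.sum_congr rfl fun l _ => by ring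
          _ = _ := by rw [← h3]; ring
      rw [h2] at h1
      exact nonneg_of_mul_nonneg_right h1 hpos
    intro s hs
    have h1 := closure_minimal hsub hcl
    rw [closure_Ico hab.ne] at h1
    exact h1 hs

end IntervalGram

/-! ### Reduction to finite semidefinite programs -/

section FiniteSDP

open Matrix

theorem OptProblem.value_eq_of_image {V W : Type*} {P : OptProblem V} {S : OptProblem W}
    (L : W → V) (h : L '' S.feasible = P.feasible)
    (hobj : ∀ x, S.objective x = P.objective (L x)) : S.value = P.value := by
  unfold OptProblem.value
  rw [← h, iInf_image]
  simp only [hobj]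

/-- A system of affine equations on a finite-dimensional space is equivalent to a finite one. -/
theorem exists_finite_affine_system {E κ : Type*} [AddCommGroup E] [Module ℝ E]
    [FiniteDimensional ℝ E] (T : κ → E →ₗ[ℝ] ℝ) (c : κ → ℝ) :
    ∃ (M : ℕ) (T' : E →ₗ[ℝ] (Fin M → ℝ)) (c' : Fin M → ℝ),
      ∀ x, (∀ k, T k x = c k) ↔ T' x = c' := by
  -- Both sides of the system lie in this finite-dimensional space, where equality can be tested on
  -- coordinates.
  set F : Submodule ℝ (κ → ℝ) := LinearMap.range (LinearMap.pi T) ⊔ ℝ ∙ c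
  have hT : ∀ x, LinearMap.pi T x ∈ F := fun x => Submodule.mem_sup_left ⟨x, rfl⟩
  have hc : c ∈ F := Submodule.mem_sup_right (Submodule.mem_span_singleton_self c)
  set e := (Module.finBasis ℝ F).equivFun
  refine ⟨_, e.toLinearMap ∘ₗ (LinearMap.pi T).codRestrict F hT, e ⟨c, hc⟩, fun x => ?_⟩
  simp only [LinearMap.comp_apply, LinearEquiv.coe_coe, EmbeddingLike.apply_eq_iff_eq,
    Subtype.ext_iff, LinearMap.codRestrict_apply]
  exact ⟨fun h => funext h, fun h k => congrFun h k⟩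

theorem _root_.LinearMap.sum_smul_apply_single {ι F : Type*} [Fintype ι] [DecidableEq ι]
    [AddCommGroup F] [Module ℝ F] (T : (ι → ℝ) →ₗ[ℝ] F) (x : ι → ℝ) :
    ∑ i, x i • T (Pi.single i 1) = T x := by
  rw [LinearMap.pi_apply_eq_sum_univ T x]
  refine Finset.sum_congr rfl fun i _ => ?_
  congr 2
  funext j
  simp [Pi.single_apply, eq_comm]

/-- A problem over a finite-dimensional space whose constraints are affine equations and finitely
many linear images of cones of positive semidefinite matrices is equivalent to a finite SDP. -/
theorem OptProblem.exists_finiteSDP {V κ β : Type*} [AddCommGroup V] [Module ℝ V]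
    [FiniteDimensional ℝ V] [Fintype β] {J ω : β → Type*} [∀ b, Fintype (J b)]
    (P : OptProblem V) (o : V →ₗ[ℝ] ℝ) (T : κ → V →ₗ[ℝ] ℝ) (c : κ → ℝ)
    (N : ∀ b, ω b → V →ₗ[ℝ] ℝ) (Λ : ∀ b, ω b → Matrix (J b) (J b) ℝ →ₗ[ℝ] ℝ)
    (hobj : ∀ v, P.objective v = o v)
    (hfeas : ∀ v, v ∈ P.feasible ↔ (∀ k, T k v = c k) ∧
      ∀ b, ∃ Q : Matrix (J b) (J b) ℝ, Q.PosSemidef ∧ ∀ w, N b w v = Λ b w Q) :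
    ∃ S : FiniteSDP, P.IsEquivalentTo S := by
  -- The SDP variables are unrestricted matrices Q, entering only through Q + Qᵀ; this makes every
  -- coefficient matrix symmetric.
  let sym : ∀ b, Matrix (J b) (J b) ℝ →ₗ[ℝ] Matrix (J b) (J b) ℝ := fun b =>
    LinearMap.id + (Matrix.transposeLinearEquiv (J b) (J b) ℝ ℝ).toLinearMap
  have hsym : ∀ b Q, sym b Q = Q + Qᵀ := fun b Q => rfl
  let pr : ∀ b, (V × ∀ b, Matrix (J b) (J b) ℝ) →ₗ[ℝ] Matrix (J b) (J b) ℝ := fun b =>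
    sym b ∘ₗ LinearMap.proj b ∘ₗ LinearMap.snd ℝ V _
  have hpr : ∀ b x, pr b x = x.2 b + (x.2 b)ᵀ := fun b x => rfl
  obtain ⟨M, T', c', hT'⟩ := exists_finite_affine_system
    (E := V × ∀ b, Matrix (J b) (J b) ℝ) (κ := κ ⊕ Σ b, ω b)
    (Sum.elim (fun k => T k ∘ₗ LinearMap.fst ℝ V _)
      (fun p => N p.1 p.2 ∘ₗ LinearMap.fst ℝ V _ - Λ p.1 p.2 ∘ₗ pr p.1))
    (Sum.elim c 0)
  let φ := (Module.finBasis ℝ (V × ∀ b, Matrix (J b) (J b) ℝ)).equivFun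
  let eβ := Fintype.equivFin β
  let eJ : ∀ b, J b ≃ Fin (Fintype.card (J b)) := fun b => Fintype.equivFin (J b)
  let blk : ∀ b : Fin (Fintype.card β), (Fin _ → ℝ) →ₗ[ℝ]
      Matrix (Fin (Fintype.card (J (eβ.symm b)))) (Fin (Fintype.card (J (eβ.symm b)))) ℝ := fun b =>
    (Matrix.reindexLinearEquiv ℝ ℝ (eJ (eβ.symm b)) (eJ (eβ.symm b))).toLinearMap ∘ₗ
      pr (eβ.symm b) ∘ₗ φ.symm.toLinearMap
  have hblk : ∀ b x, blk b x
      = (pr (eβ.symm b) (φ.symm x)).submatrix (eJ (eβ.symm b)).symm (eJ (eβ.symm b)).symm :=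
    fun b x => rfl
  let S : FiniteSDP :=
    { numVars := _
      cost := fun v => o (φ.symm (Pi.single v 1)).1
      numEqs := M
      eqMat := LinearMap.toMatrix' (T' ∘ₗ φ.symm.toLinearMap)
      eqRhs := c'
      numBlocks := Fintype.card β
      blockSize := fun b => Fintype.card (J (eβ.symm b))
      constMat := fun b => 0
      coefMat := fun b v => blk b (Pi.single v 1)
      constMat_symm := fun b => Matrix.isSymm_zero
      coefMat_symm := fun b v => by
        rw [hblk, hpr]
        exact (Matrix.isSymm_add_transpose_self _).submatrix _ }
  have hS : ∀ x, x ∈ S.toProblem.feasible ↔ (∀ k, T k (φ.symm x).1 = c k) ∧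
      ∀ b, (pr b (φ.symm x)).PosSemidef ∧ ∀ w, N b w (φ.symm x).1 = Λ b w (pr b (φ.symm x)) := by
    intro x
    have h1 : x ∈ S.toProblem.feasible ↔ S.eqMat.mulVec x = S.eqRhs ∧
      ∀ b, (S.constMat b + ∑ v, x v • S.coefMat b v).PosSemidef := Iff.rfl
    have h2 : S.eqMat.mulVec x = T' (φ.symm x) := by
      change (LinearMap.toMatrix' (T' ∘ₗ φ.symm.toLinearMap)) *ᵥ x = _
      rw [LinearMap.toMatrix'_mulVec]; rfl
    have h3 : ∀ b, S.constMat b + ∑ v, x v • S.coefMat b v = blk b x := by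
      intro b
      change 0 + ∑ v, x v • blk b (Pi.single v 1) = blk b x
      rw [zero_add, LinearMap.sum_smul_apply_single]
    have h4 : (∀ b, (blk b x).PosSemidef) ↔ ∀ b, (pr b (φ.symm x)).PosSemidef := by
      simp only [hblk, Matrix.posSemidef_submatrix_equiv]
      exact (eβ.symm.surjective.forall (p := fun b => (pr b (φ.symm x)).PosSemidef)).symm
    have h5 := hT' (φ.symm x)
    rw [h1, h2]
    change T' (φ.symm x) = c' ∧ _ ↔ _
    rw [← h5]
    simp only [h3]
    have h6 : (∀ b, (blk b x).PosSemidef) ↔ ∀ b, (pr b (φ.symm x)).PosSemidef := h4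
    simp only [Sum.forall, Sum.elim_inl, Sum.elim_inr, Sigma.forall, LinearMap.sub_apply,
      LinearMap.comp_apply, LinearMap.fst_apply, Pi.zero_apply, sub_eq_zero]
    constructor
    · rintro ⟨⟨ha, hb⟩, hc⟩
      exact ⟨ha, fun b => ⟨h6.1 hc b, hb b⟩⟩
    · rintro ⟨ha, hb⟩
      exact ⟨⟨ha, fun b => (hb b).2⟩, h6.2 fun b => (hb b).1⟩
  let L : (Fin S.numVars → ℝ) →ₗ[ℝ] V := LinearMap.fst ℝ V _ ∘ₗ φ.symm.toLinearMap
  have hL : L '' S.toProblem.feasible = P.feasible := by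
    ext v
    rw [hfeas]
    constructor
    · rintro ⟨x, hx, rfl⟩
      obtain ⟨ha, hb⟩ := (hS x).1 hx
      exact ⟨ha, fun b => ⟨_, hb b⟩⟩
    · rintro ⟨ha, hb⟩
      choose Q hQ hQN using hb
      -- Symmetrizing without halving doubles a symmetric matrix, hence the factor 1/2.
      have hpq : ∀ b, pr b (v, fun b => (1 / 2 : ℝ) • Q b) = Q b := by
        intro b
        rw [hpr]
        have h1 : (Q b)ᵀ = Q b := by
          have := (hQ b).isHermitian
          rwa [IsHermitian, conjTranspose_eq_transpose_of_trivial] at this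
        simp only [transpose_smul, h1]
        rw [← add_smul]
        norm_num
      refine ⟨φ (v, fun b => (1 / 2 : ℝ) • Q b), (hS _).2 ?_, ?_⟩
      · rw [LinearEquiv.symm_apply_apply]
        refine ⟨ha, fun b => ?_⟩
        rw [hpq]
        exact ⟨hQ b, hQN b⟩
      · simp [L]
  have hLo : ∀ x, S.toProblem.objective x = P.objective (L x) := by
    intro x
    rw [hobj]
    change ∑ v, o (φ.symm (Pi.single v 1)).1 * x v = (o ∘ₗ L) x
    rw [← LinearMap.sum_smul_apply_single (o ∘ₗ L) x]
    exact Finset.sum_congr rfl fun v _ => mul_comm _ _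
  exact ⟨S, ⟨L, hL, hLo⟩, OptProblem.value_eq_of_image L hL hLo⟩

end FiniteSDP

/-! ### The piecewise polynomial problem as a finite SDP -/

section PiecewisePolynomial

open Matrix Polynomial

variable {n nR np : ℕ}

instance (N : ℕ) (f : MvPolynomial (Fin n) ℝ) : Finite (LMIIdx N f) :=
  Finite.of_injective
    (fun β : LMIIdx N f => (⟨β.1, by have := β.2; omega⟩ : MultiIdx n N))
    fun _ _ h => Subtype.ext (Subtype.mk.inj h)

instance (d : ℕ) : FiniteDimensional ℝ (degreeLE ℝ (d : WithBot ℕ)) := by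
  rw [← degreeLT_succ_eq_degreeLE]
  exact Module.Finite.equiv (degreeLTEquiv ℝ (d + 1)).symm

/-- Evaluation at `s` of component `b` of piece `i` of a piecewise polynomial vector. -/
noncomputable def evalPiece {d nT : ℕ} {ι : Type*} (i : Fin nT) (b : ι) (s : ℝ) :
    (Fin nT → ι → degreeLE ℝ (d : WithBot ℕ)) →ₗ[ℝ] ℝ :=
  leval s ∘ₗ (degreeLE ℝ (d : WithBot ℕ)).subtype ∘ₗ LinearMap.proj b ∘ₗ LinearMap.proj i

theorem evalPiece_apply {d nT : ℕ} {ι : Type*} (i : Fin nT) (b : ι) (s : ℝ)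
    (y : Fin nT → ι → degreeLE ℝ (d : WithBot ℕ)) : evalPiece i b s y = (y i b).1.eval s := rfl

/-- The derivative at `s` of component `b` of piece `i` of a piecewise polynomial vector. -/
noncomputable def derivPiece {d nT : ℕ} {ι : Type*} (i : Fin nT) (b : ι) (s : ℝ) :
    (Fin nT → ι → degreeLE ℝ (d : WithBot ℕ)) →ₗ[ℝ] ℝ :=
  leval s ∘ₗ derivative ∘ₗ (degreeLE ℝ (d : WithBot ℕ)).subtype ∘ₗ
    LinearMap.proj b ∘ₗ LinearMap.proj i

theorem derivPiece_apply {d nT : ℕ} {ι : Type*} (i : Fin nT) (b : ι) (s : ℝ)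
    (y : Fin nT → ι → degreeLE ℝ (d : WithBot ℕ)) :
    derivPiece i b s y = (derivative (y i b).1).eval s := rfl

/-- There is one Gram matrix for each piece and each polynomial `f i`. The dynamics are indexed by
all real times and the Gram identities by all real x; both infinite families are affine, which is
all that `OptProblem.exists_finiteSDP` needs. -/
theorem pwpOCP_isEquivalentTo_finiteSDP (R : ReactionNetwork n nR) (m : ℕ)
    (f : Fin np → MvPolynomial (Fin n) ℝ) (y₀ : MomentVec n (m + R.q)) (d : ℕ) {nT : ℕ}
    (t : Fin (nT + 1) → ℝ) (ht : StrictMono t) (k : Fin nT) (tf : ℝ)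
    (j : MultiIdx n (m + R.q)) :
    ∃ S : FiniteSDP, (pwpOCP R m f y₀ d t k tf j).IsEquivalentTo S := by
  classical
  let _ : ∀ p : Fin nT × Fin np, Fintype (LMIIdx (m + R.q) (f p.2)) := fun p => Fintype.ofFinite _
  refine OptProblem.exists_finiteSDP
    (κ := ({p : Fin nT × ℝ // p.2 ∈ Set.Icc (t p.1.castSucc) (t p.1.succ)} × MultiIdx n m) ⊕
      ({p : Fin nT × Fin nT // (p.1 : ℕ) + 1 = p.2} × MultiIdx n (m + R.q)) ⊕
      ({i : Fin nT // (i : ℕ) = 0} × MultiIdx n (m + R.q)))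
    (β := Fin nT × Fin np)
    (J := fun p => LMIIdx (m + R.q) (f p.2) × Fin (d + 1))
    (ω := fun p => ℝ × LMIIdx (m + R.q) (f p.2) × LMIIdx (m + R.q) (f p.2))
    _ (evalPiece k j tf)
    (Sum.elim
      (fun p => derivPiece p.1.1.1 (p.2.lift R.q) p.1.1.2
        - ∑ b, R.dynMat m p.2 b • evalPiece p.1.1.1 b p.1.1.2)
      (Sum.elim (fun p => evalPiece p.1.1.1 p.2 (t p.1.1.1.succ)
          - evalPiece p.1.1.2 p.2 (t p.1.1.1.succ))
        fun p => evalPiece p.1.1 p.2 0))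
    (Sum.elim (fun _ => 0) (Sum.elim (fun _ => 0) fun p => y₀ p.2))
    (fun p w => (1 + w.1 ^ 2) ^ d • ∑ b : MultiIdx n (m + R.q),
      (f p.2 * MvPolynomial.monomial (w.2.1.1 + w.2.2.1) 1).coeff b.1 •
        evalPiece p.1 b ((t p.1.castSucc + t p.1.succ * w.1 ^ 2) / (1 + w.1 ^ 2)))
    (fun p w => ∑ a : Fin (d + 1), ∑ b : Fin (d + 1), w.1 ^ (a + b : ℕ) •
      Matrix.entryLinearMap ℝ ℝ (w.2.1, a) (w.2.2, b))
    (fun v => rfl) (fun y => ?_)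
  have hdyn : (∀ i, ∀ s ∈ Set.Icc (t i.castSucc) (t i.succ), ∀ a : MultiIdx n m,
      (derivative (y i (a.lift R.q)).1).eval s
        = (R.dynMat m).mulVec (fun b => (y i b).1.eval s) a) ↔
      ∀ p : {p : Fin nT × ℝ // p.2 ∈ Set.Icc (t p.1.castSucc) (t p.1.succ)} × MultiIdx n m,
        (derivPiece p.1.1.1 (p.2.lift R.q) p.1.1.2
          - ∑ b, R.dynMat m p.2 b • evalPiece p.1.1.1 b p.1.1.2 :
          (Fin nT → MultiIdx n (m + R.q) → degreeLE ℝ (d : WithBot ℕ)) →ₗ[ℝ] ℝ) y = 0 := by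
    simp only [LinearMap.sub_apply, LinearMap.sum_apply, LinearMap.smul_apply, evalPiece_apply,
      derivPiece_apply, sub_eq_zero, smul_eq_mul, Prod.forall, Subtype.forall, mulVec, dotProduct]
  have hcone : ∀ p : Fin nT × Fin np,
      (∀ s ∈ Set.Icc (t p.1.castSucc) (t p.1.succ),
        (momentMatrix (f p.2) fun b => (y p.1 b).1.eval s).PosSemidef) ↔
      ∃ Q : Matrix (LMIIdx (m + R.q) (f p.2) × Fin (d + 1))
        (LMIIdx (m + R.q) (f p.2) × Fin (d + 1)) ℝ, Q.PosSemidef ∧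
        ∀ w : ℝ × LMIIdx (m + R.q) (f p.2) × LMIIdx (m + R.q) (f p.2),
        ((1 + w.1 ^ 2) ^ d • ∑ b : MultiIdx n (m + R.q),
          (f p.2 * MvPolynomial.monomial (w.2.1.1 + w.2.2.1) 1).coeff b.1 •
            evalPiece p.1 b ((t p.1.castSucc + t p.1.succ * w.1 ^ 2) / (1 + w.1 ^ 2)) :
            (Fin nT → MultiIdx n (m + R.q) → degreeLE ℝ (d : WithBot ℕ)) →ₗ[ℝ] ℝ) y
        = (∑ a : Fin (d + 1), ∑ b : Fin (d + 1), w.1 ^ (a + b : ℕ) •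
            Matrix.entryLinearMap ℝ ℝ (w.2.1, a) (w.2.2, b) :
            Matrix (LMIIdx (m + R.q) (f p.2) × Fin (d + 1)) _ ℝ →ₗ[ℝ] ℝ) Q := by
    intro p
    have h := posSemidef_on_Icc_iff d (ht (Fin.castSucc_lt_succ (i := p.1)))
      (fun β γ : LMIIdx (m + R.q) (f p.2) => ∑ b : MultiIdx n (m + R.q),
        C ((f p.2 * MvPolynomial.monomial (β.1 + γ.1) 1).coeff b.1) * (y p.1 b).1)
      (fun β γ => natDegree_sum_le_of_forall_le _ _ fun b _ =>
        (natDegree_C_mul_le _ _).trans (natDegree_le_iff_degree_le.2 (mem_degreeLE.1 (y p.1 b).2)))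
      (fun β γ => by simp only [add_comm])
    simp only [eval_finsetSum, eval_mul, eval_C] at h
    refine h.trans (exists_congr fun Q => and_congr_right fun _ => ?_)
    simp only [Prod.forall, LinearMap.smul_apply, LinearMap.sum_apply, evalPiece_apply,
      smul_eq_mul, Matrix.entryLinearMap_apply, mul_comm (Q _ _)]
  simp only [Sum.forall, Sum.elim_inl, Sum.elim_inr]
  rw [← hdyn]
  simp only [← hcone]
  simp only [pwpOCP, momentCone, LinearMap.sub_apply, evalPiece_apply, sub_eq_zero, Prod.forall,
    Subtype.forall, Set.mem_ofPred_eq, and_assoc]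
  refine and_congr_right fun _ => and_congr_right fun _ => and_congr_right fun _ => ?_
  exact forall_congr' fun i => ⟨fun h a s hs => h s hs a, fun h s hs a => h a s hs⟩

end PiecewisePolynomial

open MeasureTheory

/-! ### Stability of the moment cone under integration -/

section Cone

variable {n np : ℕ}

/-- The cone `C(X)` is an intersection of closed half-spaces. -/
theorem exists_momentCone_eq (N : ℕ) (f : Fin np → MvPolynomial (Fin n) ℝ) :
    ∃ Φ : Set (MomentVec n N →L[ℝ] ℝ), ∀ y, y ∈ momentCone N f ↔ ∀ φ ∈ Φ, 0 ≤ φ y := by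
  classical
  let _ : ∀ i, Fintype (LMIIdx N (f i)) := fun i => Fintype.ofFinite _
  let φ : ∀ i, (LMIIdx N (f i) → ℝ) → MomentVec n N →ₗ[ℝ] ℝ := fun i v =>
    ∑ β, ∑ γ, (v β * v γ) • ∑ k : MultiIdx n N,
      (f i * MvPolynomial.monomial (β.1 + γ.1) 1).coeff k.1 • LinearMap.proj k
  have hφ : ∀ i v y, φ i v y = ∑ β, ∑ γ, v β * momentMatrix (f i) y β γ * v γ := by
    intro i v y
    simp only [φ, LinearMap.sum_apply, LinearMap.smul_apply, LinearMap.proj_apply, smul_eq_mul,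
      momentMatrix, riesz]
    exact Finset.sum_congr rfl fun β _ => Finset.sum_congr rfl fun γ _ => by ring
  refine ⟨{ψ | ∃ i v, ψ = LinearMap.toContinuousLinearMap (φ i v)}, fun y => ?_⟩
  have hsymm : ∀ i (β γ : LMIIdx N (f i)),
      momentMatrix (f i) y β γ = momentMatrix (f i) y γ β := fun i β γ => by
    simp only [momentMatrix, add_comm]
  constructor
  · rintro h _ ⟨i, v, rfl⟩
    rw [LinearMap.coe_toContinuousLinearMap', hφ]
    exact (Matrix.posSemidef_iff_sum_nonneg.1 (h i)).2 v
  · intro h i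
    refine Matrix.posSemidef_iff_sum_nonneg.2 ⟨hsymm i, fun v => ?_⟩
    rw [← hφ]
    exact h _ ⟨i, v, rfl⟩

/-- The functionals defining the half-spaces commute with the integral. If `h` is not integrable,
the integral is 0 by convention, which also lies in the cone. -/
theorem integral_mem_momentCone {N : ℕ} {f : Fin np → MvPolynomial (Fin n) ℝ}
    {h : ℝ → MomentVec n N} {x y : ℝ} (hxy : x ≤ y)
    (hh : ∀ s ∈ Set.Icc x y, h s ∈ momentCone N f) : ∫ s in x..y, h s ∈ momentCone N f := by
  obtain ⟨Φ, hΦ⟩ := exists_momentCone_eq N f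
  simp only [hΦ] at hh ⊢
  intro φ hφ
  by_cases hi : IntervalIntegrable h volume x y
  · rw [← φ.intervalIntegral_comp_comm hi]
    exact intervalIntegral.integral_nonneg hxy fun s hs => hh s hs φ hφ
  · rw [intervalIntegral.integral_undef hi, map_zero]

theorem smul_mem_momentCone {N : ℕ} {f : Fin np → MvPolynomial (Fin n) ℝ} {c : ℝ} (hc : 0 ≤ c)
    {y : MomentVec n N} (hy : y ∈ momentCone N f) : c • y ∈ momentCone N f := by
  obtain ⟨Φ, hΦ⟩ := exists_momentCone_eq N f
  rw [hΦ] at hy ⊢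
  intro φ hφ
  rw [map_smul]
  exact mul_nonneg hc (hy φ hφ)

/-- For s in [x, y] the pair (x, s) is again ordered, so integration uses the hypothesis only where
it holds. -/
theorem iterate_intL_mem_momentCone {N : ℕ} {f : Fin np → MvPolynomial (Fin n) ℝ}
    {h : ℝ → ℝ → MomentVec n N} (hh : ∀ x y, x ≤ y → h x y ∈ momentCone N f) (a : ℕ) :
    ∀ x y, x ≤ y → (intL^[a] h) x y ∈ momentCone N f := by
  induction a with
  | zero => exact hh
  | succ a ih =>
    rw [Function.iterate_succ_apply']
    exact fun x y hxy => integral_mem_momentCone hxy fun s hs => ih x s hs.1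

theorem iterate_intR_mem_momentCone {N : ℕ} {f : Fin np → MvPolynomial (Fin n) ℝ}
    {h : ℝ → ℝ → MomentVec n N} (hh : ∀ x y, x ≤ y → h x y ∈ momentCone N f) (a : ℕ) :
    ∀ x y, x ≤ y → (intR^[a] h) x y ∈ momentCone N f := by
  induction a with
  | zero => exact hh
  | succ a ih =>
    rw [Function.iterate_succ_apply']
    exact fun x y hxy => integral_mem_momentCone hxy fun s hs => ih s y hs.2

end Cone

/-! ### Iterated integrals from a base point -/

section IteratedIntegrals

variable {E : Type*} [NormedAddCommGroup E] [NormedSpace ℝ E]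

/-- The iterated integrals of `F` with base point `0`. -/
noncomputable def iterInt (F : ℝ → E) : ℕ → ℝ → E
  | 0 => F
  | l + 1 => fun x => ∫ s in (0 : ℝ)..x, iterInt F l s

theorem iterInt_succ (F : ℝ → E) (l : ℕ) (x : ℝ) :
    iterInt F (l + 1) x = ∫ s in (0 : ℝ)..x, iterInt F l s := rfl

theorem iterInt_succ_zero (F : ℝ → E) (l : ℕ) : iterInt F (l + 1) 0 = 0 := by
  rw [iterInt_succ, intervalIntegral.integral_same]

variable [CompleteSpace E]

theorem continuous_iterInt {F : ℝ → E} (hF : Continuous F) (l : ℕ) :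
    Continuous (iterInt F l) := by
  induction l with
  | zero => exact hF
  | succ l ih =>
    exact continuous_iff_continuousAt.2 fun x =>
      (ih.integral_hasStrictDerivAt 0 x).hasDerivAt.continuousAt

theorem hasDerivAt_iterInt {F : ℝ → E} (hF : Continuous F) (l : ℕ) (x : ℝ) :
    HasDerivAt (iterInt F (l + 1)) (iterInt F l x) x :=
  ((continuous_iterInt hF l).integral_hasStrictDerivAt 0 x).hasDerivAt

/-- The maps `Ω_{l,k}` of the iterated integrals of a cone-valued function lie in the cone. -/
theorem omegaMap_iterInt_mem {n np N : ℕ} {f : Fin np → MvPolynomial (Fin n) ℝ}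
    {F : ℝ → MomentVec n N} (hF : Continuous F) (hC : ∀ s, F s ∈ momentCone N f)
    {l k : ℕ} (hk : k < l) {x y : ℝ} (hxy : x ≤ y) :
    omegaMap l k (fun s : Fin l => iterInt F (s + 1) x) (fun s : Fin l => iterInt F (s + 1) y) x y
      ∈ momentCone N f := by
  obtain ⟨a, rfl⟩ : ∃ a, l = a + k + 1 := ⟨l - 1 - k, by omega⟩
  -- The entry with index s in `omegaMap` stands for level s + 1.
  have h := omegaMap_eq (fun s => iterInt F (s + 1)) (continuous_iterInt hF 1)
    (fun s t => hasDerivAt_iterInt hF (s + 1) t) a k x y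
  rw [← h]
  refine iterate_intL_mem_momentCone (iterate_intR_mem_momentCone ?_ k) a x y hxy
  intro x y hxy
  have hint : ∀ u v, IntervalIntegrable F volume u v := fun u v => hF.intervalIntegrable u v
  -- The innermost function is the increment of the first integral, the integral of `F` over [x, y].
  change (∫ s in (0 : ℝ)..y, F s) - (∫ s in (0 : ℝ)..x, F s) ∈ momentCone N f
  rw [intervalIntegral.integral_interval_sub_left (hint _ _) (hint _ _)]
  exact integral_mem_momentCone hxy fun s _ => hC s

variable {E' : Type*} [NormedAddCommGroup E'] [NormedSpace ℝ E'] [CompleteSpace E']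

/-- It moves Γ, K and the coordinate projections through the iterated integrals. -/
theorem iterInt_map {F : ℝ → E} (hF : Continuous F) (L : E →L[ℝ] E') (l : ℕ) (x : ℝ) :
    L (iterInt F l x) = iterInt (fun s => L (F s)) l x := by
  induction l generalizing x with
  | zero => rfl
  | succ l ih =>
    rw [iterInt_succ, iterInt_succ,
      ← L.intervalIntegral_comp_comm ((continuous_iterInt hF l).intervalIntegrable _ _)]
    simp only [ih]

/-- If `G` integrates to `F - c` on `[0, T]`, then the iterated integrals of `G` are those of
`F`, up to the iterated integrals of the constant `c`. -/
theorem iterInt_succ_eq {F G : ℝ → E} (hF : Continuous F) {T : ℝ} {c : E}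
    (h : ∀ x ∈ Set.Icc 0 T, ∫ s in (0 : ℝ)..x, G s = F x - c) (l : ℕ) :
    ∀ x ∈ Set.Icc 0 T, iterInt G (l + 1) x = iterInt F l x - (x ^ l / (l.factorial : ℝ)) • c := by
  induction l with
  | zero => simpa [iterInt] using h
  | succ l ih =>
    intro x hx
    have h1 : ∫ s in (0 : ℝ)..x, iterInt G (l + 1) s
        = ∫ s in (0 : ℝ)..x, (iterInt F l s - (s ^ l / (l.factorial : ℝ)) • c) := by
      refine intervalIntegral.integral_congr fun s hs => ih s ?_
      rw [Set.uIcc_of_le hx.1] at hs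
      exact ⟨hs.1, hs.2.trans hx.2⟩
    rw [iterInt_succ, h1, intervalIntegral.integral_sub
      ((continuous_iterInt hF l).intervalIntegrable _ _)
      (Continuous.intervalIntegrable (by fun_prop) _ _), intervalIntegral.integral_smul_const,
      ← iterInt_succ, intervalIntegral.integral_div, integral_pow]
    congr 2
    rw [Nat.factorial_succ]
    push_cast
    have : (l.factorial : ℝ) ≠ 0 := by positivity
    field_simp
    simp

end IteratedIntegrals

/-! ### Feasible points of the bounding SDP from trajectories -/

section MomentTrajectory

variable {n nR np nF nS : ℕ}

/-- Integration by parts. Absolute continuity of `g a` is what makes its almost everywhere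
derivative sufficient. -/
theorem IsTestFamily.integral_mul_eq {tT : ℝ} {g : Fin nF → ℝ → ℝ}
    {D : Matrix (Fin nF) (Fin nF) ℝ} (hg : IsTestFamily tT g D) {x : ℝ} (hx : x ∈ Set.Icc 0 tT)
    {U W : ℝ → ℝ} (hU : ∀ s, HasDerivAt U (W s) s) (hW : Continuous W) (a : Fin nF) :
    ∫ s in (0 : ℝ)..x, ((∑ b, D a b * g b s) * U s + g a s * W s)
      = g a x * U x - g a 0 * U 0 := by
  have hsub : Set.uIcc 0 x ⊆ Set.uIcc 0 tT := by
    rw [Set.uIcc_of_le hx.1, Set.uIcc_of_le (hx.1.trans hx.2)]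
    exact Set.Icc_subset_Icc_right hx.2
  have hUc : ContDiff ℝ 1 U := contDiff_one_iff_deriv.2
    ⟨fun s => (hU s).differentiableAt, by
      have : deriv U = W := funext fun s => (hU s).deriv
      rwa [this]⟩
  rw [← ((hg.absCont a).mono hsub).integral_deriv_mul_eq_sub
    (hUc.contDiffOn.absolutelyContinuousOnInterval)]
  refine intervalIntegral.integral_congr_ae ?_
  have h1 := (ae_restrict_iff' measurableSet_Icc).1 (hg.deriv_mem_span a)
  filter_upwards [h1] with s hs hs'
  rw [Set.uIoc_of_le hx.1] at hs'
  rw [(hs ⟨hs'.1.le, hs'.2.trans hx.2⟩).deriv, (hU s).deriv]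

/-- `low` as a continuous linear map. -/
noncomputable def lowCLM (R : ReactionNetwork n nR) (m : ℕ) :
    MomentVec n (m + R.q) →L[ℝ] MomentVec n m :=
  LinearMap.toContinuousLinearMap (LinearMap.funLeft ℝ ℝ fun j : MultiIdx n m => j.lift R.q)

theorem lowCLM_apply (R : ReactionNetwork n nR) (m : ℕ) (v : MomentVec n (m + R.q)) :
    lowCLM R m v = R.low m v := rfl

/-- `gammaMap` as a continuous linear map. -/
noncomputable def gammaCLM (R : ReactionNetwork n nR) (m : ℕ) (D : Matrix (Fin nF) (Fin nF) ℝ)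
    (a : Fin nF) : (Fin nF → MomentVec n (m + R.q)) →L[ℝ] MomentVec n m :=
  LinearMap.toContinuousLinearMap ((R.dynMat m).mulVecLin ∘ₗ LinearMap.proj a +
    (lowCLM R m).toLinearMap ∘ₗ ∑ b, D a b • LinearMap.proj b)

theorem gammaCLM_apply (R : ReactionNetwork n nR) (m : ℕ) (D : Matrix (Fin nF) (Fin nF) ℝ)
    (a : Fin nF) (z : Fin nF → MomentVec n (m + R.q)) :
    gammaCLM R m D a z = gammaMap R m D a z := by
  simp only [gammaMap, ← lowCLM_apply]
  simp [gammaCLM]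

/-- The iterated generalized moments along a solution of the moment dynamics with values in the
cone form a feasible point of the bounding SDP. -/
theorem exists_boundingSDP_feasible (R : ReactionNetwork n nR) (m : ℕ)
    (f : Fin np → MvPolynomial (Fin n) ℝ) {tT T : ℝ} (hT : 0 ≤ T) (hTt : T ≤ tT)
    {g : Fin nF → ℝ → ℝ} {D : Matrix (Fin nF) (Fin nF) ℝ} (hg : IsTestFamily tT g D)
    {τ : Fin (nS + 1) → ℝ} (hτ0 : τ 0 = 0) (hτ : StrictMono τ) (hτT : τ (Fin.last nS) ≤ T)
    (nI : ℕ) {S₀ : Set (MomentVec n (m + R.q) × (Fin nF → Fin nI → MomentVec n (m + R.q)))}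
    (p : Fin nS) (j : MultiIdx n (m + R.q)) {Y : ℝ → MomentVec n (m + R.q)}
    (hYc : ContinuousOn Y (Set.Icc 0 T))
    (hYd : ∀ x ∈ Set.Icc 0 T, ∀ a : MultiIdx n m, Y x (a.lift R.q)
      = Y 0 (a.lift R.q) + ∫ s in (0 : ℝ)..x, (R.dynMat m).mulVec (Y s) a)
    (hYC : ∀ s ∈ Set.Icc 0 T, Y s ∈ momentCone (m + R.q) f) (hS₀ : (Y 0, 0) ∈ S₀) :
    ∃ X ∈ (boundingSDP R m f g D τ nI S₀ p j).feasible, ∀ r, X.y r = Y (τ r) := by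
  -- A retraction of the line onto [0, T]; composing with it makes the integrands continuous
  -- everywhere without changing them on [0, T].
  set c : ℝ → ℝ := fun s => max 0 (min T s) with hc
  have hcc : Continuous c := by fun_prop
  have hcm : ∀ s, c s ∈ Set.Icc 0 T := fun s =>
    ⟨le_max_left _ _, max_le hT (min_le_left _ _)⟩
  have hcs : ∀ s ∈ Set.Icc 0 T, c s = s := fun s hs => by
    simp [hc, min_eq_right hs.2, max_eq_right hs.1]
  have h0 : (0 : ℝ) ∈ Set.Icc 0 T := ⟨le_rfl, hT⟩
  have hτm : ∀ r, τ r ∈ Set.Icc 0 T := fun r =>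
    ⟨hτ0 ▸ hτ.monotone (Fin.zero_le r), (hτ.monotone (Fin.le_last r)).trans hτT⟩
  have hgc : ∀ a, Continuous fun s => g a (c s) := fun a => by
    refine ((hg.absCont a).continuousOn).comp_continuous hcc fun s => ?_
    rw [Set.uIcc_of_le (hT.trans hTt)]
    exact Set.Icc_subset_Icc_right hTt (hcm s)
  have hYcc : Continuous fun s => Y (c s) := hYc.comp_continuous hcc hcm
  set F : Fin nF → ℝ → MomentVec n (m + R.q) := fun a s => g a (c s) • Y (c s) with hF
  have hFc : ∀ a, Continuous (F a) := fun a => (hgc a).smul hYcc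
  have hFpi : Continuous fun s b => F b s := continuous_pi hFc
  have hFC : ∀ a s, F a s ∈ momentCone (m + R.q) f := fun a s =>
    smul_mem_momentCone (hg.nonneg a _ (Set.Icc_subset_Icc_right hTt (hcm s))) (hYC _ (hcm s))
  -- The integrand is (g Y_L)' = g A Y + g' Y_L, so the integral telescopes.
  have hbase : ∀ a, ∀ x ∈ Set.Icc 0 T,
      ∫ s in (0 : ℝ)..x, gammaCLM R m D a (fun b => F b s)
        = lowCLM R m (F a x) - g a 0 • lowCLM R m (Y 0) := by
    intro a x hx
    have hint : IntervalIntegrable (fun s => gammaCLM R m D a (fun b => F b s)) volume 0 x :=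
      ((gammaCLM R m D a).continuous.comp hFpi).intervalIntegrable _ _
    funext i
    have h1 := (ContinuousLinearMap.proj (R := ℝ) (φ := fun _ : MultiIdx n m => ℝ)
      i).intervalIntegral_comp_comm hint
    simp only [ContinuousLinearMap.proj_apply] at h1
    rw [← h1]
    set W : ℝ → ℝ := fun s => (R.dynMat m).mulVec (Y (c s)) i with hW
    have hWc : Continuous W := by
      simp only [hW, Matrix.mulVec, dotProduct]
      exact continuous_finsetSum _ fun b _ =>
        continuous_const.mul ((continuous_apply b).comp hYcc)
    -- A continuously differentiable extension to the whole line of a lower order component of `Y`,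
    -- as integration by parts requires.
    set U : ℝ → ℝ := fun x => Y 0 (i.lift R.q) + ∫ s in (0 : ℝ)..x, W s with hU
    have hUY : ∀ x ∈ Set.Icc 0 T, U x = Y x (i.lift R.q) := by
      intro x hx
      rw [hYd x hx]
      refine congrArg (Y 0 (i.lift R.q) + ·) (intervalIntegral.integral_congr fun s hs => ?_)
      rw [Set.uIcc_of_le hx.1] at hs
      simp only [hW, hcs s ⟨hs.1, hs.2.trans hx.2⟩]
    have hUd : ∀ s, HasDerivAt U (W s) s := fun s =>
      ((hWc.integral_hasStrictDerivAt 0 s).hasDerivAt).const_add _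
    have h2 := hg.integral_mul_eq ⟨hx.1, hx.2.trans hTt⟩ hUd hWc a
    have h3 : lowCLM R m (F a x) i - g a 0 * lowCLM R m (Y 0) i = g a x * U x - g a 0 * U 0 := by
      rw [hUY x hx, hUY 0 h0]
      simp [lowCLM_apply, ReactionNetwork.low, hF, hcs x hx]
    change _ = lowCLM R m (F a x) i - g a 0 * lowCLM R m (Y 0) i
    rw [h3, ← h2]
    refine intervalIntegral.integral_congr fun s hs => ?_
    rw [Set.uIcc_of_le hx.1] at hs
    have hs' : s ∈ Set.Icc 0 T := ⟨hs.1, hs.2.trans hx.2⟩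
    simp only [gammaCLM_apply, gammaMap, hF, hcs s hs', hW, hUY s hs', Pi.add_apply,
      ReactionNetwork.low, Finset.sum_apply, Pi.smul_apply, smul_eq_mul, Matrix.mulVec_smul]
    rw [add_comm, Finset.sum_mul]
    congr 1
    exact Finset.sum_congr rfl fun b _ => by ring
  have hgamma : ∀ a l, ∀ x ∈ Set.Icc 0 T, gammaMap R m D a (fun b => iterInt (F b) (l + 1) x)
      = R.low m (iterInt (F a) l x - (x ^ l / (l.factorial : ℝ) * g a 0) • Y 0) := by
    intro a l x hx
    have h1 : (fun b => iterInt (F b) (l + 1) x) = iterInt (fun s b => F b s) (l + 1) x := by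
      funext b
      exact (iterInt_map hFpi (ContinuousLinearMap.proj (R := ℝ)
        (φ := fun _ : Fin nF => MomentVec n (m + R.q)) b) (l + 1) x).symm
    rw [h1, ← gammaCLM_apply, iterInt_map hFpi,
      iterInt_succ_eq ((lowCLM R m).continuous.comp (hFc a)) (hbase a) l x hx]
    rw [← lowCLM_apply, map_sub, map_smul, iterInt_map (hFc a), mul_smul]
    rfl
  refine ⟨⟨fun r => Y (τ r), fun a r l => iterInt (F a) l (τ r)⟩, ⟨⟨?_, ?_, ?_, ?_⟩, ?_⟩,
    fun r => rfl⟩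
  · intro a r
    simp [iterInt, hF, hcs _ (hτm r.succ)]
  · exact fun r => hYC _ (hτm _)
  · intro a r l
    simp only [Fin.val_succ, Fin.val_castSucc, hτ0]
    rw [hgamma a l _ (hτm _)]
    split_ifs with hr
    · rfl
    · have hpos : 0 < τ r.castSucc := by
        rw [← hτ0]
        exact hτ (Fin.pos_iff_ne_zero.2 fun h => hr (by simpa using congrArg Fin.val h))
      rw [hgamma a l _ (hτm _)]
      simp only [← lowCLM_apply, ← map_smul, ← map_add]
      congr 1
      -- The recursion is the identity `hgamma` at the right time minus the scaled one at the left
      -- time; this factor cancels the terms in `Y 0`.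
      have h1 : (τ r.succ / τ r.castSucc) ^ (l : ℕ) * τ r.castSucc ^ (l : ℕ)
          = τ r.succ ^ (l : ℕ) := by
        rw [← mul_pow, div_mul_cancel₀ _ hpos.ne']
      rw [smul_sub, smul_smul, ← mul_assoc, ← mul_div_assoc, h1]
      abel
  · intro a r l k hl hk
    exact omegaMap_iterInt_mem (hFc a) (hFC a) hk (hτ Fin.castSucc_lt_succ).le
  -- Integrals from 0 to 0 vanish, so the initial data are exactly the pair that `S₀` is assumed to
  -- contain.
  · have h1 : (Y (τ 0), fun a (l : Fin nI) => iterInt (F a) (l.succ : Fin (nI + 1)) (τ 0))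
        = (Y 0, 0) := by
      rw [hτ0]
      refine Prod.ext rfl ?_
      funext a l
      exact iterInt_succ_zero _ _
    rw [← h1] at hS₀
    exact hS₀

end MomentTrajectory

/-! ### Gluing functions along a partition -/

section Pieces

/-- The subintervals of a partition cover the whole interval. -/
theorem exists_mem_piece {nT : ℕ} {t : Fin (nT + 1) → ℝ} (k : Fin nT) {s : ℝ}
    (hs : s ∈ Set.Icc (t 0) (t (Fin.last nT))) :
    ∃ i : Fin nT, s ∈ Set.Icc (t i.castSucc) (t i.succ) := by
  by_contra! hn
  have h1 : ∀ i : Fin (nT + 1), t i ≤ s := by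
    intro i
    induction i using Fin.induction with
    | zero => exact hs.1
    | succ i ih => exact (not_le.1 fun h => hn i ⟨ih, h⟩).le
  obtain ⟨nT, rfl⟩ : ∃ r, nT = r + 1 := ⟨nT - 1, by have := k.2; omega⟩
  exact hn (Fin.last nT) ⟨h1 _, by rw [Fin.succ_last]; exact hs.2⟩

/-- Functions on the subintervals of a partition that agree at the breakpoints agree on the
intersections of the subintervals. -/
theorem piece_eq_of_mem {E : Type*} {nT : ℕ} {t : Fin (nT + 1) → ℝ} (ht : StrictMono t)
    {w : Fin nT → ℝ → E}
    (hw : ∀ i i' : Fin nT, (i : ℕ) + 1 = i' → w i (t i.succ) = w i' (t i.succ))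
    {i i' : Fin nT} {s : ℝ} (hi : s ∈ Set.Icc (t i.castSucc) (t i.succ))
    (hi' : s ∈ Set.Icc (t i'.castSucc) (t i'.succ)) : w i s = w i' s := by
  have key : ∀ i i' : Fin nT, i < i' → s ∈ Set.Icc (t i.castSucc) (t i.succ) →
      s ∈ Set.Icc (t i'.castSucc) (t i'.succ) → w i s = w i' s := by
    intro i i' hlt hi hi'
    have h1 : i'.castSucc ≤ i.succ := ht.le_iff_le.1 (hi'.1.trans hi.2)
    -- Distinct pieces that meet are neighbours, and they meet only at their common breakpoint.
    have h2 : (i : ℕ) + 1 = i' := by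
      have h3 : (i' : ℕ) ≤ i + 1 := h1
      have h4 : (i : ℕ) < i' := hlt
      omega
    have h5 : i'.castSucc = i.succ := Fin.ext (by simp [h2])
    have h6 : s = t i.succ := le_antisymm hi.2 (h5 ▸ hi'.1)
    rw [h6]
    exact hw i i' h2
  rcases lt_trichotomy i i' with h | rfl | h
  · exact key i i' h hi hi'
  · rfl
  · exact (key i' i h hi' hi).symm

/-- Gluing functions on the subintervals of a partition that agree at the breakpoints. -/
theorem exists_glue {E : Type*} {nT : ℕ} {t : Fin (nT + 1) → ℝ} (ht : StrictMono t)
    {w : Fin nT → ℝ → E} (k : Fin nT)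
    (hw : ∀ i i' : Fin nT, (i : ℕ) + 1 = i' → w i (t i.succ) = w i' (t i.succ)) :
    ∃ Y : ℝ → E, ∀ i, ∀ s ∈ Set.Icc (t i.castSucc) (t i.succ), Y s = w i s := by
  classical
  refine ⟨fun s => if h : ∃ i : Fin nT, s ∈ Set.Icc (t i.castSucc) (t i.succ) then
    w h.choose s else w k s, fun i s hs => ?_⟩
  have h : ∃ i : Fin nT, s ∈ Set.Icc (t i.castSucc) (t i.succ) := ⟨i, hs⟩
  simp only [dif_pos h]
  exact piece_eq_of_mem ht hw h.choose_spec hs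

end Pieces

/-! ### From piecewise polynomials to feasible points of the bounding SDP -/

theorem pwpOCP_feasible_restriction {n nR np nF nS nI : ℕ} (R : ReactionNetwork n nR) (m : ℕ)
    (f : Fin np → MvPolynomial (Fin n) ℝ) (y₀ : MomentVec n (m + R.q)) (d : ℕ) {nT : ℕ}
    {tT : ℝ} {t : Fin (nT + 1) → ℝ} (ht0 : t 0 = 0) (ht : StrictMono t)
    (htT : t (Fin.last nT) ≤ tT) (k : Fin nT) {tf : ℝ}
    (htf : tf ∈ Set.Icc (t k.castSucc) (t k.succ)) (j : MultiIdx n (m + R.q))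
    {g : Fin nF → ℝ → ℝ} {D : Matrix (Fin nF) (Fin nF) ℝ} (hg : IsTestFamily tT g D)
    {τ : Fin (nS + 1) → ℝ} (hτ0 : τ 0 = 0) (hτ : StrictMono τ)
    (hτT : τ (Fin.last nS) ≤ t (Fin.last nT)) {p : Fin nS} (hp : τ p.succ = tf)
    {S₀ : Set (MomentVec n (m + R.q) × (Fin nF → Fin nI → MomentVec n (m + R.q)))}
    (hS₀ : (y₀, 0) ∈ S₀) :
    ∀ y ∈ (pwpOCP R m f y₀ d t k tf j).feasible,
      ∃ x ∈ (boundingSDP R m f g D τ nI S₀ p j).feasible,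
        (∀ r i, τ r ∈ Set.Icc (t (Fin.castSucc i)) (t i.succ) →
          ∀ b, x.y r b = (y i b).1.eval (τ r)) ∧
        (boundingSDP R m f g D τ nI S₀ p j).objective x
          = (pwpOCP R m f y₀ d t k tf j).objective y := by
  rintro y ⟨hdyn, hcont, hinit, hcone⟩
  obtain ⟨Y, hY⟩ := exists_glue ht (w := fun i s b => (y i b).1.eval s) k
    fun i i' h => funext (hcont i i' h)
  set T := t (Fin.last nT) with hTdef
  have hT : 0 ≤ T := ht0 ▸ ht.monotone (Fin.zero_le _)
  have hcover : ∀ s ∈ Set.Icc 0 T, ∃ i : Fin nT, s ∈ Set.Icc (t i.castSucc) (t i.succ) :=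
    fun s hs => exists_mem_piece k (by rwa [ht0])
  have hYc : ContinuousOn Y (Set.Icc 0 T) := by
    refine ((locallyFinite_of_finite fun i : Fin nT =>
      Set.Icc (t i.castSucc) (t i.succ)).continuousOn_iUnion (fun i => isClosed_Icc)
      fun i => ?_).mono fun s hs => Set.mem_iUnion.2 (hcover s hs)
    refine ContinuousOn.congr (f := fun s b => (y i b).1.eval s) ?_ (hY i)
    exact continuousOn_pi.2 fun b => (y i b).1.continuous.continuousOn
  have hY0 : Y 0 = y₀ := by
    obtain ⟨nT, rfl⟩ : ∃ r, nT = r + 1 := ⟨nT - 1, by have := k.2; omega⟩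
    have h0 : (0 : ℝ) ∈ Set.Icc (t (0 : Fin (nT + 1)).castSucc) (t (0 : Fin (nT + 1)).succ) := by
      constructor
      · rw [Fin.castSucc_zero, ht0]
      · rw [← ht0]; exact ht.monotone (Fin.zero_le _)
    rw [hY 0 0 h0]
    exact funext (hinit 0 rfl)
  have hYd : ∀ x ∈ Set.Icc 0 T, ∀ a : MultiIdx n m, Y x (a.lift R.q)
      = Y 0 (a.lift R.q) + ∫ s in (0 : ℝ)..x, (R.dynMat m).mulVec (Y s) a := by
    intro x hx a
    have hsub : Set.Icc 0 x ⊆ Set.Icc 0 T := Set.Icc_subset_Icc_right hx.2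
    have hAc : ContinuousOn (fun s => (R.dynMat m).mulVec (Y s) a) (Set.Icc 0 x) := by
      simp only [Matrix.mulVec, dotProduct]
      exact continuousOn_finsetSum _ fun b _ => continuousOn_const.mul
        (continuousOn_pi.1 (hYc.mono hsub) b)
    -- The breakpoints form a finite exceptional set for the fundamental theorem of calculus;
    -- elsewhere `Y` agrees near s with a single polynomial piece.
    have h1 := integral_eq_of_hasDerivAt_off_countable_of_le (fun s => Y s (a.lift R.q))
      (fun s => (R.dynMat m).mulVec (Y s) a) hx.1 (Set.finite_range t).countable
      (continuousOn_pi.1 (hYc.mono hsub) _) ?_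
      (hAc.intervalIntegrable_of_Icc hx.1)
    · rw [h1]; ring
    · rintro s ⟨hs, hst⟩
      obtain ⟨i, hi⟩ := hcover s ⟨hs.1.le, hs.2.le.trans hx.2⟩
      have hi' : s ∈ Set.Ioo (t i.castSucc) (t i.succ) :=
        ⟨lt_of_le_of_ne hi.1 fun h => hst ⟨_, h⟩, lt_of_le_of_ne hi.2 fun h => hst ⟨_, h.symm⟩⟩
      have h2 := (y i (a.lift R.q)).1.hasDerivAt s
      rw [hdyn i s hi a] at h2
      rw [hY i s hi]
      refine h2.congr_of_eventuallyEq ?_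
      filter_upwards [isOpen_Ioo.mem_nhds hi'] with u hu
      rw [hY i u (Set.Ioo_subset_Icc_self hu)]
  obtain ⟨X, hX, hXY⟩ := exists_boundingSDP_feasible R m f hT htT hg hτ0 hτ hτT nI p j hYc hYd
    (fun s hs => by
      obtain ⟨i, hi⟩ := hcover s hs
      rw [hY i s hi]
      exact hcone i s hi)
    (S₀ := S₀) (by rwa [hY0])
  have hXe : ∀ r i, τ r ∈ Set.Icc (t (Fin.castSucc i)) (t i.succ) →
      ∀ b, X.y r b = (y i b).1.eval (τ r) := fun r i hr b => by
    rw [hXY, hY i _ hr]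
  refine ⟨X, hX, hXe, ?_⟩
  change X.y p.succ j = (y k j).1.eval tf
  rw [hXe p.succ k (by rwa [hp]), hp]

theorem OptProblem.value_le_of_restriction {V W : Type*} {P : OptProblem V} {S : OptProblem W}
    (h : ∀ y ∈ P.feasible, ∃ x ∈ S.feasible, S.objective x = P.objective y) :
    S.value ≤ P.value := by
  refine le_iInf₂ fun y hy => ?_
  obtain ⟨x, hx, hxy⟩ := h y hy
  exact (iInf₂_le x hx).trans_eq (by rw [hxy])

end MomentBounds

theorem mainTheorem8 {n nR np : ℕ} (R : MomentBounds.ReactionNetwork n nR) (m : ℕ)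
    (f : Fin np → MvPolynomial (Fin n) ℝ) (y₀ : MomentBounds.MomentVec n (m + R.q))
    (d nT : ℕ) (tT : ℝ) (t : Fin (nT + 1) → ℝ)
    (ht0 : t 0 = 0) (ht : StrictMono t) (htT : t (Fin.last nT) ≤ tT)
    (k : Fin nT) (tf : ℝ) (htf : tf ∈ Set.Icc (t k.castSucc) (t k.succ))
    (j : MomentBounds.MultiIdx n (m + R.q)) :
    -- (pwpOCP) is equivalent to a finite SDP
    (∃ S : MomentBounds.FiniteSDP,
      (MomentBounds.pwpOCP R m f y₀ d t k tf j).IsEquivalentTo S) ∧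
    -- (pwpOCP) is a restriction of (SDP)
    (∀ (nF nS nI : ℕ) (g : Fin nF → ℝ → ℝ) (D : Matrix (Fin nF) (Fin nF) ℝ)
      (τ : Fin (nS + 1) → ℝ)
      (S₀ : Set (MomentBounds.MomentVec n (m + R.q) ×
        (Fin nF → Fin nI → MomentBounds.MomentVec n (m + R.q))))
      (p : Fin nS),
      MomentBounds.IsTestFamily tT g D →
      τ 0 = 0 → StrictMono τ → τ (Fin.last nS) ≤ t (Fin.last nT) → τ p.succ = tf →
      (y₀, 0) ∈ S₀ →
      (∀ y ∈ (MomentBounds.pwpOCP R m f y₀ d t k tf j).feasible,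
        ∃ x ∈ (MomentBounds.boundingSDP R m f g D τ nI S₀ p j).feasible,
          (∀ r i, τ r ∈ Set.Icc (t (Fin.castSucc i)) (t i.succ) →
            ∀ b, x.y r b = (y i b).1.eval (τ r)) ∧
          (MomentBounds.boundingSDP R m f g D τ nI S₀ p j).objective x
            = (MomentBounds.pwpOCP R m f y₀ d t k tf j).objective y) ∧
      (MomentBounds.boundingSDP R m f g D τ nI S₀ p j).value
        ≤ (MomentBounds.pwpOCP R m f y₀ d t k tf j).value) := by
  refine ⟨MomentBounds.pwpOCP_isEquivalentTo_finiteSDP R m f y₀ d t ht k tf j, ?_⟩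
  intro nF nS nI g D τ S₀ p hg hτ0 hτ hτT hp hS₀
  have h := MomentBounds.pwpOCP_feasible_restriction R m f y₀ d ht0 ht htT k htf j hg hτ0 hτ hτT
    hp hS₀
  refine ⟨h, MomentBounds.OptProblem.value_le_of_restriction fun y hy => ?_⟩
  obtain ⟨x, hx, -, hxy⟩ := h y hy
  exact ⟨x, hx, hxy⟩
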